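/- For a measure $\nu$ on a metric space, let $\underline D(\nu,x)=\liminf_{r\to0}\frac{\log\nu(B(x,r))}{\log r}$ be its lower local dimension at $x$, and let $\overline{\dim}_H\,\nu$ be the $\nu$-essential supremum of $x\mapsto\underline D(\nu,x)$ (the upper Hausdorff dimension of $\nu$). Write $|A|$ for the diameter of $A$, and let $\mathcal H^s_\infty(A)=\inf\{\sum_i|B_i|^s: A\subset\bigcup_iB_i\}$, over countable covers by balls of $\mathbb R^d$, be the $s$-dimensional Hausdorff content. Let $X\subset\mathbb R^d$ be compact, and let $\mu$ be a $\delta$-Ahlfors regular measure on $X$, that is, $\delta>0$ and $\mu$ is a non-atomic Borel probability measure on $X$ for which there is a constant $K\ge1$ with $K^{-1}r^\delta\le\mu(B(x,r))\le Kr^\delta$ for all $x\in X$ and $0<r\le|X|$ (balls are open balls of $X$). Let $\nu$ be a Borel probability measure on $X$ that is quasi-self-conformal with respect to a sequence $(F_n)$ of closed subsets of $X$: there is a constant $C\ge1$ such that for every $n$ one has $\nu(F_n)>0$ and there is a bijection $f_n:F_n\to X$ with $$C^{-1}\frac{|x-y|}{|F_n|}\le|f_n(x)-f_n(y)|\le C\frac{|x-y|}{|F_n|}\quad(x,y\in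 F_n),\qquad C^{-1}\nu(A)\le\frac{\nu(f_n^{-1}(A))}{\nu(F_n)}\le C\,\nu(A)\quad(A\subset X\text{ Borel}).$$ Assume that $|F_n|\to0$ and $\mu(\limsup_{n\to\infty}F_n)=1$. Let $s\ge0$, let $x_n\in X$ and $r_n>0$, and let $E_n$ be (relatively) open subsets of $X$ such that 1. $r_n\to0$ as $n\to\infty$; 2. $\nu(\limsup_{n\to\infty}B(x_n,r_n))=1$; 3. $E_n\subset B(x_n,r_n)$ for all $n$, and there is a constant $c>0$ with $\mathcal H^s_\infty(E_n)\ge c\,r_n^{\overline{\dim}_H\,\nu}$ for all $n$. Then $s\le\dim_HX$, and $\limsup_{n\to\infty}E_n$ belongs to Falconer's large intersection class $\mathscr G^s(X)$: it is a $G_\delta$ subset of $X$, and there is a constant $c'>0$ such that $\mathcal H^t_\infty\big(B\cap\limsup_{n\to\infty}E_n\big)>c'\,\mathcal H^t_\infty(B)$ for all $0<t<s$ and all balls $B$ of $X$. -/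

import Mathlib

open Filter Topology MeasureTheory Set
open scoped ENNReal

/-- The `s`-dimensional Hausdorff content of `A`: the infimum of `∑ |B|^s` over all countable (finite
or infinite) families of balls, given by their centres and positive radii, that cover `A`. -/
noncomputable def hausdorffContent {Y : Type*} [PseudoMetricSpace Y] (s : ℝ) (A : Set Y) : ℝ≥0∞ :=
  ⨅ (𝓑 : Set (Y × ℝ)) (_ : 𝓑.Countable) (_ : ∀ b ∈ 𝓑, 0 < b.2)
    (_ : A ⊆ ⋃ b ∈ 𝓑, Metric.ball b.1 b.2),
    ∑' b : 𝓑, Metric.ediam (Metric.ball b.1.1 b.1.2) ^ s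

/-- `μ` is a `δ`-Ahlfors regular measure on `Y`: a non-atomic probability measure with
`μ (B(x,r)) ≍ r ^ δ`, uniformly over the points `x` and the radii `0 < r ≤ |Y|`. -/
structure IsAhlforsRegular {Y : Type*} [PseudoMetricSpace Y] [MeasurableSpace Y]
    (δ : ℝ) (μ : Measure Y) : Prop where
  pos : 0 < δ
  isProbabilityMeasure : IsProbabilityMeasure μ
  measure_singleton : ∀ x : Y, μ {x} = 0
  comparable : ∃ C : ℝ, 1 ≤ C ∧ ∀ (x : Y) (r : ℝ), 0 < r → r ≤ Metric.diam (univ : Set Y) →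
    ENNReal.ofReal (C⁻¹ * r ^ δ) ≤ μ (Metric.ball x r) ∧
      μ (Metric.ball x r) ≤ ENNReal.ofReal (C * r ^ δ)

/-- The lower local dimension `liminf_{r → 0} log ν(B(x,r)) / log r` of `ν` at `x`, with values in
the extended reals; it is `⊤` at points outside the support of `ν`. -/
noncomputable def lowerLocalDim {Y : Type*} [PseudoMetricSpace Y] [MeasurableSpace Y]
    (ν : Measure Y) (x : Y) : EReal :=
  liminf (fun r : ℝ => ENNReal.log (ν (Metric.ball x r)) / (Real.log r : EReal)) (𝓝[>] 0)

/-- The upper Hausdorff dimension of `ν`: the `ν`-essential supremum of its lower local dimension. -/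
noncomputable def upperHausdorffDim {Y : Type*} [PseudoMetricSpace Y] [MeasurableSpace Y]
    (ν : Measure Y) : EReal :=
  essSup (lowerLocalDim ν) ν

/-- Quasi-self-conformality of the Borel probability measure `ν` on `Y` with respect to a family
`F` of closed sets: with one constant `C`, each `F i` is mapped bijectively onto `Y` by a map that
distorts the rescaled distances `dist x y / |F i|` by at most `C`, and that carries the
normalised restriction of `ν` to `F i` to a measure comparable to `ν`. (The lower bound in the
last clause forces `ν (F i) ≠ 0`, because `0 / 0 = 0`.) -/
structure IsQuasiSelfConformal {Y ι : Type*} [PseudoMetricSpace Y] [MeasurableSpace Y]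
    (ν : Measure Y) (F : ι → Set Y) : Prop where
  isProbabilityMeasure : IsProbabilityMeasure ν
  isClosed : ∀ i, IsClosed (F i)
  exists_maps : ∃ C : ℝ, 1 ≤ C ∧ ∀ i, ∃ f : F i → Y, Function.Bijective f ∧
    (∀ x y : F i, C⁻¹ * (dist x y / Metric.diam (F i)) ≤ dist (f x) (f y) ∧
      dist (f x) (f y) ≤ C * (dist x y / Metric.diam (F i))) ∧
    (∀ A : Set Y, MeasurableSet A →
      ENNReal.ofReal C⁻¹ * ν A ≤ ν (Subtype.val '' (f ⁻¹' A)) / ν (F i) ∧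
        ν (Subtype.val '' (f ⁻¹' A)) / ν (F i) ≤ ENNReal.ofReal C * ν A)

/-- Falconer's large intersection class `𝒢^s(X)` of a set `X ⊆ ℝ^d` (meaningful for
`0 < s ≤ dim_H X`): the `G_δ` subsets `A` of `X` for which there is `c > 0` such that
`ℋ^t_∞(A ∩ B) > c ℋ^t_∞(B)` for all `0 < t < s` and all balls `B` of `X`. The contents are
those of subsets of `ℝ^d`. -/
def largeIntersectionClass {d : ℕ} (X : Set (EuclideanSpace ℝ (Fin d))) (s : ℝ) : Set (Set X) :=
  {A | IsGδ A ∧ ∃ c : ℝ, 0 < c ∧ ∀ t : ℝ, 0 < t → t < s → ∀ (x : X) (r : ℝ), 0 < r →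
    ENNReal.ofReal c * hausdorffContent t (Subtype.val '' Metric.ball x r) <
      hausdorffContent t (Subtype.val '' (A ∩ Metric.ball x r))}

/-!
Write `D` for the upper Hausdorff dimension of `ν` and `U N = ⋃ n ≥ N, E n`, so that
`limsup E = ⋂ N, U N` is an intersection of open sets. Let `t < s`.

*Content near the sets `F m`.* The contents of the `E n ⊆ B(x n, r n)` force `s ≤ D`. Since `D` is an
essential supremum, for every `a < D` there is a set of positive `ν`-measure on which
`ν (B(x, r)) ≲ r ^ a` for all small `r`, and self-conformality transports it to every `F m`, at scale
`|F m|` and with uniform constants (`IsQuasiSelfConformal.exists_decay`). The balls `B(x n, r n)`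
cover `ν`-almost all of this set. With `t < a < D` and `D - a < s - t`, the decay of `ν` shows that
`E n` has `t`-content larger than the share of `ν` in a multiple of `B(x n, r n)`, and a covering
argument gives `U N` content at least `c |F m| ^ t` in every neighbourhood of `F m`, with `c`
independent of `m` and `N` (`le_radiusContent_inter_thickening`).

*Intersecting the open sets.* Start from the restriction of `μ` to a ball. The sets `F m` are
arbitrarily small and cover `μ`-almost everything, so a measure of bounded density can be cut into
pieces of small size `η` close to sets `F m`, and each piece can be moved into `U N` near its `F m`
along a Frostman measure (`AhlforsBounds.exists_frostman`). At scales above `η` hardly anything has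
changed; at scales below, a piece has mass about `η ^ δ`, which is negligible against `η ^ t`
because `t < δ`. Hence mass and growth constant are almost preserved, whatever `c` is
(`IsFrostmanOn.exists_dispersion`). After doing this for all `N` in turn, with summable errors,
compactness turns the growth bounds into a lower bound for the content of `⋂ N, U N` in the ball,
which is uniform in `t` (`IsFrostmanOn.le_radiusContent_iInter_inter`).

Contents are computed throughout from radii of balls centred in `X`, which changes them by bounded
factors only. Finally `s ≤ δ` because some `E n` has positive `s`-content, and `δ ≤ dim_H X` by mass
distribution.
-/

/-! ### Contents and regular measures -/

/-- The `t`-dimensional content of `A` computed from the radii of the covering balls instead of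
their diameters. The centres are points of the ambient space `Y` of `A`; for a subspace of `ℝ^d`
this makes the content intrinsic up to a factor `2 ^ t`. -/
noncomputable def radiusContent {Y : Type*} [PseudoMetricSpace Y] (t : ℝ) (A : Set Y) : ℝ≥0∞ :=
  ⨅ (𝓑 : Set (Y × ℝ)) (_ : 𝓑.Countable) (_ : ∀ b ∈ 𝓑, 0 < b.2)
    (_ : A ⊆ ⋃ b ∈ 𝓑, Metric.ball b.1 b.2), ∑' b : 𝓑, ENNReal.ofReal (b.1.2 ^ t)

/-- The measure of a ball of radius `r` is between `K⁻¹ * r ^ δ` and `K * r ^ δ`. The upper bound is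
required of all radii; the lower one can only hold up to the diameter of the space. -/
structure AhlforsBounds {Y : Type*} [PseudoMetricSpace Y] [MeasurableSpace Y]
    (δ K : ℝ) (μ : Measure Y) : Prop where
  dim_pos : 0 < δ
  one_le : 1 ≤ K
  diam_pos : 0 < Metric.diam (univ : Set Y)
  lower : ∀ (x : Y) (r : ℝ), 0 < r → r ≤ Metric.diam (univ : Set Y) →
    ENNReal.ofReal (K⁻¹ * r ^ δ) ≤ μ (Metric.ball x r)
  upper : ∀ (x : Y) (r : ℝ), 0 < r → μ (Metric.ball x r) ≤ ENNReal.ofReal (K * r ^ δ)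

section Content

variable {Y : Type*} [PseudoMetricSpace Y]

theorem radiusContent_le {t : ℝ} {A : Set Y} (𝓑 : Set (Y × ℝ)) (hc : 𝓑.Countable)
    (hpos : ∀ b ∈ 𝓑, 0 < b.2) (hA : A ⊆ ⋃ b ∈ 𝓑, Metric.ball b.1 b.2) :
    radiusContent t A ≤ ∑' b : 𝓑, ENNReal.ofReal (b.1.2 ^ t) :=
  iInf_le_of_le 𝓑 <| iInf_le_of_le hc <| iInf_le_of_le hpos <| iInf_le _ hA

theorem le_radiusContent {t : ℝ} {A : Set Y} {a : ℝ≥0∞}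
    (h : ∀ 𝓑 : Set (Y × ℝ), 𝓑.Countable → (∀ b ∈ 𝓑, 0 < b.2) →
      A ⊆ ⋃ b ∈ 𝓑, Metric.ball b.1 b.2 → a ≤ ∑' b : 𝓑, ENNReal.ofReal (b.1.2 ^ t)) :
    a ≤ radiusContent t A :=
  le_iInf fun 𝓑 => le_iInf fun hc => le_iInf fun hpos => le_iInf fun hA => h 𝓑 hc hpos hA

theorem radiusContent_mono {t : ℝ} {A B : Set Y} (h : A ⊆ B) :
    radiusContent t A ≤ radiusContent t B :=
  le_radiusContent fun 𝓑 hc hpos hB => radiusContent_le 𝓑 hc hpos (h.trans hB)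

theorem hausdorffContent_le {t : ℝ} {A : Set Y} (𝓑 : Set (Y × ℝ)) (hc : 𝓑.Countable)
    (hpos : ∀ b ∈ 𝓑, 0 < b.2) (hA : A ⊆ ⋃ b ∈ 𝓑, Metric.ball b.1 b.2) :
    hausdorffContent t A ≤ ∑' b : 𝓑, Metric.ediam (Metric.ball b.1.1 b.1.2) ^ t :=
  iInf_le_of_le 𝓑 <| iInf_le_of_le hc <| iInf_le_of_le hpos <| iInf_le _ hA

/-- A version of `radiusContent_le` for indexed families of balls. -/
theorem radiusContent_le_tsum {ι : Type*} [Countable ι] {t : ℝ} {A : Set Y} (c : ι → Y) (ρ : ι → ℝ)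
    (hpos : ∀ i, 0 < ρ i) (hA : A ⊆ ⋃ i, Metric.ball (c i) (ρ i)) :
    radiusContent t A ≤ ∑' i, ENNReal.ofReal (ρ i ^ t) := by
  refine (radiusContent_le (range fun i => (c i, ρ i)) (countable_range _) ?_ ?_).trans ?_
  · rintro _ ⟨i, rfl⟩
    exact hpos i
  · rw [biUnion_range]
    exact hA
  · exact ENNReal.tsum_le_tsum_comp_of_surjective (rangeFactorization_surjective
      (f := fun i => (c i, ρ i))) (fun b => ENNReal.ofReal (b.1.2 ^ t))

theorem hausdorffContent_le_tsum {ι : Type*} [Countable ι] {t : ℝ} {A : Set Y} (c : ι → Y)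
    (ρ : ι → ℝ) (hpos : ∀ i, 0 < ρ i) (hA : A ⊆ ⋃ i, Metric.ball (c i) (ρ i)) :
    hausdorffContent t A ≤ ∑' i, Metric.ediam (Metric.ball (c i) (ρ i)) ^ t := by
  refine (hausdorffContent_le (range fun i => (c i, ρ i)) (countable_range _) ?_ ?_).trans ?_
  · rintro _ ⟨i, rfl⟩
    exact hpos i
  · rw [biUnion_range]
    exact hA
  · exact ENNReal.tsum_le_tsum_comp_of_surjective (rangeFactorization_surjective
      (f := fun i => (c i, ρ i))) (fun b => Metric.ediam (Metric.ball b.1.1 b.1.2) ^ t)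

theorem ediam_ball_rpow_le {t : ℝ} (ht : 0 ≤ t) (x : Y) {r : ℝ} (hr : 0 < r) :
    Metric.ediam (Metric.ball x r) ^ t ≤ ENNReal.ofReal ((2 * r) ^ t) := by
  rw [← ENNReal.ofReal_rpow_of_pos (by positivity)]
  refine ENNReal.rpow_le_rpow ?_ ht
  rw [ENNReal.ofReal_mul two_pos.le, ← Metric.eball_ofReal]
  simpa using Metric.ediam_eball_le (x := x) (r := ENNReal.ofReal r)

theorem hausdorffContent_subset_ball_le {t : ℝ} (ht : 0 ≤ t) {A : Set Y} (x : Y) {r : ℝ}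
    (hr : 0 < r) (hA : A ⊆ Metric.ball x r) :
    hausdorffContent t A ≤ ENNReal.ofReal ((2 * r) ^ t) := by
  refine (hausdorffContent_le_tsum (ι := Unit) (fun _ => x) (fun _ => r) (fun _ => hr)
    (hA.trans (subset_iUnion_of_subset () subset_rfl))).trans ?_
  simpa using ediam_ball_rpow_le ht x hr

theorem radiusContent_subset_ball_le {t : ℝ} {A : Set Y} (x : Y) {r : ℝ}
    (hr : 0 < r) (hA : A ⊆ Metric.ball x r) :
    radiusContent t A ≤ ENNReal.ofReal (r ^ t) := by
  simpa using radiusContent_le_tsum (t := t) (ι := Unit) (fun _ => x) (fun _ => r) (fun _ => hr)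
    (hA.trans (subset_iUnion_of_subset () subset_rfl))

theorem hausdorffContent_image_le_radiusContent {Z : Set Y} {t : ℝ} (ht : 0 ≤ t) (A : Set Z) :
    hausdorffContent t (Subtype.val '' A) ≤ ENNReal.ofReal (2 ^ t) * radiusContent t A := by
  rw [← ENNReal.div_le_iff' (by simp [Real.rpow_pos_of_pos]) ENNReal.ofReal_ne_top]
  refine le_radiusContent fun 𝓑 hc hpos hA => ?_
  rw [ENNReal.div_le_iff' (by simp [Real.rpow_pos_of_pos]) ENNReal.ofReal_ne_top,
    ← ENNReal.tsum_mul_left]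
  have := hc.to_subtype
  refine (hausdorffContent_le_tsum (ι := 𝓑) (fun b => (b.1.1 : Y)) (fun b => b.1.2)
    (fun b => hpos _ b.2) ?_).trans (ENNReal.tsum_le_tsum fun b => ?_)
  · rintro _ ⟨z, hz, rfl⟩
    obtain ⟨b, hb, hzb⟩ := mem_iUnion₂.1 (hA hz)
    exact mem_iUnion.2 ⟨⟨b, hb⟩, hzb⟩
  · rw [← ENNReal.ofReal_mul (by positivity), ← Real.mul_rpow two_pos.le (hpos _ b.2).le]
    exact ediam_ball_rpow_le ht _ (hpos _ b.2)

end Content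

/-- A Euclidean ball that meets `Z` is replaced by a ball of `Z` with twice the radius; its diameter
is not less than its radius because the ambient space is not a point. -/
theorem radiusContent_le_hausdorffContent_image {V : Type*} [NormedAddCommGroup V]
    [NormedSpace ℝ V] [Nontrivial V] {Z : Set V} {t : ℝ} (ht : 0 ≤ t) (A : Set Z) :
    radiusContent t A ≤ ENNReal.ofReal (2 ^ t) * hausdorffContent t (Subtype.val '' A) := by
  have h2 : ENNReal.ofReal ((2 : ℝ) ^ t) ≠ 0 := by simp [Real.rpow_pos_of_pos]
  rw [← ENNReal.div_le_iff' h2 ENNReal.ofReal_ne_top]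
  refine le_iInf fun 𝓑 => le_iInf fun hc => le_iInf fun hpos => le_iInf fun hA => ?_
  rw [ENNReal.div_le_iff' h2 ENNReal.ofReal_ne_top, ← ENNReal.tsum_mul_left]
  let 𝓒 : Set 𝓑 := {b | ∃ z : Z, (z : V) ∈ Metric.ball b.1.1 b.1.2}
  have := hc.to_subtype
  choose z hz using fun b : 𝓒 => b.2
  have key : radiusContent t A ≤ ∑' b : 𝓒, ENNReal.ofReal ((2 * b.1.1.2) ^ t) := by
    refine radiusContent_le_tsum z (fun b => 2 * b.1.1.2)
      (fun b => mul_pos two_pos (hpos _ b.1.2)) ?_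
    intro y hy
    obtain ⟨b, hb, hyb⟩ := mem_iUnion₂.1 (hA (mem_image_of_mem _ hy))
    refine mem_iUnion.2 ⟨⟨⟨b, hb⟩, y, hyb⟩, ?_⟩
    have h1 := hz ⟨⟨b, hb⟩, y, hyb⟩
    rw [Metric.mem_ball] at h1 hyb ⊢
    rw [Subtype.dist_eq]
    have := dist_triangle_right (y : V) (z ⟨⟨b, hb⟩, y, hyb⟩ : V) b.1
    simp only at h1 ⊢
    linarith
  refine key.trans ((ENNReal.tsum_comp_le_tsum_of_injective Subtype.val_injective
    (fun b : 𝓑 => ENNReal.ofReal ((2 * b.1.2) ^ t))).trans (ENNReal.tsum_le_tsum fun b => ?_))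
  have hb := hpos _ b.2
  rw [Real.mul_rpow two_pos.le hb.le, ENNReal.ofReal_mul (by positivity)]
  gcongr
  rw [← ENNReal.ofReal_rpow_of_pos hb]
  refine ENNReal.rpow_le_rpow ?_ ht
  obtain ⟨v, hv⟩ := exists_norm_eq V (c := b.1.2 / 2) (by positivity)
  have h1 : ENNReal.ofReal b.1.2 = edist (b.1.1 + v) (b.1.1 - v) := by
    rw [edist_dist, dist_eq_norm]
    congr 1
    have : b.1.1 + v - (b.1.1 - v) = (2 : ℝ) • v := by rw [two_smul]; abel
    rw [this, norm_smul, hv, Real.norm_two]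
    ring
  rw [h1]
  apply Metric.edist_le_ediam_of_mem
  · simp [hv, hb]
  · simp [hv, hb]

section Regular

variable {Y : Type*} [MetricSpace Y] [MeasurableSpace Y]

theorem IsAhlforsRegular.exists_bounds [CompactSpace Y] {δ : ℝ} {μ : Measure Y}
    (h : IsAhlforsRegular δ μ) :
    ∃ K, AhlforsBounds δ K μ := by
  have := h.isProbabilityMeasure
  obtain ⟨C, hC, hball⟩ := h.comparable
  have hdiam : 0 < Metric.diam (univ : Set Y) := by
    by_contra hd
    have hsub : (univ : Set Y).Subsingleton := by
      intro x hx y hy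
      have := Metric.dist_le_diam_of_mem isCompact_univ.isBounded hx hy
      exact dist_le_zero.1 (by linarith)
    obtain ⟨x⟩ := Measure.nonempty_of_neZero μ
    have h1 : (univ : Set Y) = {x} := hsub.eq_singleton_of_mem (mem_univ x)
    have h2 := h.measure_singleton x
    rw [← h1] at h2
    simp at h2
  refine ⟨max C (Metric.diam (univ : Set Y) ^ δ)⁻¹, h.pos, hC.trans (le_max_left _ _), hdiam,
    fun x r hr hrd => le_trans ?_ (hball x r hr hrd).1, fun x r hr => ?_⟩
  · gcongr
    exact le_max_left _ _
  · rcases le_or_gt r (Metric.diam (univ : Set Y)) with hrd | hrd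
    · refine (hball x r hr hrd).2.trans ?_
      gcongr
      exact le_max_left _ _
    · refine prob_le_one.trans (ENNReal.one_le_ofReal.2 ?_)
      calc (1 : ℝ) = (Metric.diam (univ : Set Y) ^ δ)⁻¹ * Metric.diam (univ : Set Y) ^ δ :=
            (inv_mul_cancel₀ (by positivity)).symm
        _ ≤ _ := by
            gcongr
            · exact le_max_right _ _
            · exact h.pos.le

variable {δ K : ℝ} {μ : Measure Y}

theorem AhlforsBounds.closedBall_le (h : AhlforsBounds δ K μ) (x : Y) {r ρ : ℝ} (hr : 0 < ρ)
    (hrρ : r < ρ) : μ (Metric.closedBall x r) ≤ ENNReal.ofReal (K * ρ ^ δ) :=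
  (measure_mono (Metric.closedBall_subset_ball hrρ)).trans (h.upper x ρ hr)

/-- The content vanishes above the dimension of a regular measure: a maximal disjoint family of
balls of radius `η` has at most about `η ^ (-δ)` members, and their enlargements cover. -/
theorem AhlforsBounds.le_of_radiusContent_pos [CompactSpace Y] [BorelSpace Y]
    [IsProbabilityMeasure μ] (h : AhlforsBounds δ K μ) {s : ℝ} (hs : radiusContent s (univ : Set Y) ≠ 0) : s ≤ δ := by
  by_contra! hlt
  apply hs
  have hK : 0 < K := one_pos.trans_le h.one_le
  have key : ∀ η : ℝ, 0 < η → η ≤ Metric.diam (univ : Set Y) →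
      radiusContent s (univ : Set Y) ≤ ENNReal.ofReal (K * 6 ^ s * η ^ (s - δ)) := by
    intro η hη hηd
    obtain ⟨u, -, hdisj, hcov⟩ := Vitali.exists_disjoint_subfamily_covering_enlargement_closedBall
      (univ : Set Y) id (fun _ => η) η (fun _ _ => le_rfl) 5 (by norm_num)
    have hdisj' : u.PairwiseDisjoint fun a => Metric.ball a η :=
      hdisj.mono fun a => Metric.ball_subset_closedBall
    have hcount : u.Countable := hdisj'.countable_of_isOpen (fun _ _ => Metric.isOpen_ball)
      (fun a _ => ⟨a, Metric.mem_ball_self hη⟩)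
    have := hcount.to_subtype
    refine (radiusContent_le_tsum (ι := u) Subtype.val (fun _ => 6 * η)
      (fun _ => by positivity) ?_).trans ?_
    · intro y _
      obtain ⟨b, hb, hyb⟩ := hcov y (mem_univ _)
      refine mem_iUnion.2 ⟨⟨b, hb⟩, ?_⟩
      have := hyb (Metric.mem_closedBall_self hη.le)
      exact Metric.closedBall_subset_ball (by linarith) this
    · have e1 : ∀ b : u, ENNReal.ofReal ((6 * η) ^ s) ≤
          ENNReal.ofReal (K * 6 ^ s * η ^ (s - δ)) * μ (Metric.ball (b : Y) η) := by
        intro b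
        refine le_trans ?_ (mul_le_mul_right (h.lower b η hη hηd) _)
        rw [← ENNReal.ofReal_mul (by positivity)]
        apply ENNReal.ofReal_le_ofReal
        rw [Real.mul_rpow (by norm_num) hη.le, Real.rpow_sub hη]
        apply le_of_eq
        field_simp
      refine (ENNReal.tsum_le_tsum e1).trans ?_
      rw [ENNReal.tsum_mul_left]
      refine mul_le_of_le_one_right zero_le ?_
      rw [← measure_biUnion hcount hdisj' fun _ _ => measurableSet_ball]
      exact prob_le_one
  have hlim : Tendsto (fun η : ℝ => ENNReal.ofReal (K * 6 ^ s * η ^ (s - δ))) (𝓝[>] 0) (𝓝 0) := by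
    have h1 : Tendsto (fun η : ℝ => η ^ (s - δ)) (𝓝[>] 0) (𝓝 0) := by
      have := (Real.continuousAt_rpow_const 0 (s - δ) (Or.inr (by linarith))).tendsto
      rw [Real.zero_rpow (by linarith)] at this
      exact this.mono_left nhdsWithin_le_nhds
    have h2 := ENNReal.tendsto_ofReal (h1.const_mul (K * 6 ^ s))
    simpa using h2
  refine le_antisymm (ge_of_tendsto hlim ?_) zero_le
  filter_upwards [Ioc_mem_nhdsGT h.diam_pos] with η hη using key η hη.1 hη.2

/-- Mass distribution: a `δ`-regular measure bounds the `δ`-dimensional Hausdorff measure from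
below. -/
theorem AhlforsBounds.le_dimH [CompactSpace Y] [BorelSpace Y] [IsProbabilityMeasure μ]
    (h : AhlforsBounds δ K μ) (hs : ∀ x, μ {x} = 0) :
    ENNReal.ofReal δ ≤ dimH (univ : Set Y) := by
  have hK : 0 < K := one_pos.trans_le h.one_le
  have hδ := h.dim_pos
  have hle : (ENNReal.ofReal (K * 2 ^ δ))⁻¹ • μ ≤ μH[δ] := by
    refine Measure.le_hausdorffMeasure δ _ 1 one_pos fun A _ => ?_
    rw [Measure.smul_apply, smul_eq_mul,
      ENNReal.inv_mul_le_iff (by simp; positivity) ENNReal.ofReal_ne_top]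
    rcases A.eq_empty_or_nonempty with rfl | ⟨x, hx⟩
    · simp
    have hb : Bornology.IsBounded A := isCompact_univ.isBounded.subset (subset_univ _)
    rcases (Metric.diam_nonneg (s := A)).eq_or_lt with hd | hd
    · have : A ⊆ {x} := fun y hy => by
        have := Metric.dist_le_diam_of_mem hb hy hx
        exact dist_le_zero.1 (by linarith)
      rw [measure_mono_null this (hs x)]
      exact zero_le
    · rw [← ENNReal.ofReal_toReal hb.ediam_ne_top, ← Metric.diam.eq_def,
        ENNReal.ofReal_rpow_of_pos hd, ← ENNReal.ofReal_mul (by positivity), mul_assoc,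
        ← Real.mul_rpow two_pos.le hd.le]
      refine le_trans (measure_mono fun y hy => ?_) (h.upper x _ (by positivity))
      have := Metric.dist_le_diam_of_mem hb hy hx
      rw [Metric.mem_ball]
      linarith
  apply le_dimH_of_hausdorffMeasure_ne_zero
  rw [Real.coe_toNNReal _ hδ.le]
  intro h0
  have := hle univ
  rw [h0] at this
  simp at this

end Regular

/-! ### Frostman measures of bounded density on open sets -/

section Frostman

variable {Y : Type*} [MetricSpace Y] [MeasurableSpace Y] {δ K : ℝ} {μ : Measure Y}

/-- The restriction of `μ` to the ball `B(y, κ)`, normalised to have mass `κ ^ t`. -/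
noncomputable def spreadMeasure (μ : Measure Y) (t : ℝ) (y : Y) (κ : ℝ) : Measure Y :=
  (ENNReal.ofReal (κ ^ t) / μ (Metric.ball y κ)) • μ.restrict (Metric.ball y κ)

theorem AhlforsBounds.measure_ball_ne_top (h : AhlforsBounds δ K μ) (y : Y) {κ : ℝ} (hκ : 0 < κ) :
    μ (Metric.ball y κ) ≠ ∞ :=
  ne_top_of_le_ne_top ENNReal.ofReal_ne_top (h.upper y κ hκ)

theorem AhlforsBounds.measure_ball_ne_zero (h : AhlforsBounds δ K μ) (y : Y) {κ : ℝ} (hκ : 0 < κ)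
    (hκd : κ ≤ Metric.diam (univ : Set Y)) : μ (Metric.ball y κ) ≠ 0 := by
  have hK : 0 < K := one_pos.trans_le h.one_le
  refine ((ENNReal.ofReal_pos.2 ?_).trans_le (h.lower y κ hκ hκd)).ne'
  positivity

theorem AhlforsBounds.spreadMeasure_univ (h : AhlforsBounds δ K μ) (t : ℝ) (y : Y) {κ : ℝ}
    (hκ : 0 < κ) (hκd : κ ≤ Metric.diam (univ : Set Y)) :
    spreadMeasure μ t y κ univ = ENNReal.ofReal (κ ^ t) := by
  rw [spreadMeasure, Measure.smul_apply, Measure.restrict_apply_univ, smul_eq_mul,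
    ENNReal.div_mul_cancel (h.measure_ball_ne_zero y hκ hκd) (h.measure_ball_ne_top y hκ)]

theorem spreadMeasure_le (t : ℝ) (y : Y) (κ : ℝ) :
    spreadMeasure μ t y κ ≤ (ENNReal.ofReal (κ ^ t) / μ (Metric.ball y κ)) • μ := by
  intro A
  simp only [spreadMeasure, Measure.smul_apply, smul_eq_mul]
  gcongr
  exact Measure.restrict_le_self

theorem spreadMeasure_eq_zero [OpensMeasurableSpace Y] (t : ℝ) {y : Y} {κ : ℝ} {A : Set Y}
    (hA : Disjoint A (Metric.ball y κ)) : spreadMeasure μ t y κ A = 0 := by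
  rw [spreadMeasure, Measure.smul_apply, Measure.restrict_apply' measurableSet_ball,
    hA.inter_eq, measure_empty, smul_zero]

/-- Below dimension `δ`, spreading mass `κ ^ t` evenly over a ball of radius `κ` respects the growth
condition of exponent `t` at all scales. -/
theorem AhlforsBounds.spreadMeasure_ball_le (h : AhlforsBounds δ K μ) {t : ℝ} (ht : 0 ≤ t)
    (htδ : t ≤ δ) (y : Y) {κ : ℝ} (hκ : 0 < κ) (hκd : κ ≤ Metric.diam (univ : Set Y)) (x : Y)
    {ρ : ℝ} (hρ : 0 < ρ) :
    spreadMeasure μ t y κ (Metric.ball x ρ) ≤ ENNReal.ofReal (K ^ 2 * ρ ^ t) := by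
  have hK : 0 < K := one_pos.trans_le h.one_le
  rcases le_or_gt κ ρ with hκρ | hρκ
  · refine (measure_mono (subset_univ _)).trans ?_
    rw [h.spreadMeasure_univ t y hκ hκd]
    apply ENNReal.ofReal_le_ofReal
    calc κ ^ t ≤ ρ ^ t := by gcongr
      _ ≤ K ^ 2 * ρ ^ t := le_mul_of_one_le_left (by positivity) (one_le_pow₀ h.one_le)
  · refine (spreadMeasure_le t y κ _).trans ?_
    rw [Measure.smul_apply, smul_eq_mul]
    calc ENNReal.ofReal (κ ^ t) / μ (Metric.ball y κ) * μ (Metric.ball x ρ)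
        ≤ ENNReal.ofReal (κ ^ t) / ENNReal.ofReal (K⁻¹ * κ ^ δ) * ENNReal.ofReal (K * ρ ^ δ) := by
          gcongr
          · exact h.lower y κ hκ hκd
          · exact h.upper x ρ hρ
      _ = ENNReal.ofReal (κ ^ t / (K⁻¹ * κ ^ δ) * (K * ρ ^ δ)) := by
          rw [← ENNReal.ofReal_div_of_pos (by positivity), ← ENNReal.ofReal_mul (by positivity)]
      _ ≤ _ := by
          apply ENNReal.ofReal_le_ofReal
          have e1 : ρ ^ δ = ρ ^ t * ρ ^ (δ - t) := by rw [← Real.rpow_add hρ]; ring_nf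
          have e2 : κ ^ δ = κ ^ t * κ ^ (δ - t) := by rw [← Real.rpow_add hκ]; ring_nf
          have e3 : ρ ^ (δ - t) ≤ κ ^ (δ - t) :=
            Real.rpow_le_rpow hρ.le hρκ.le (by linarith)
          have : κ ^ t / (K⁻¹ * κ ^ δ) * (K * ρ ^ δ) =
              K ^ 2 * ρ ^ t * (ρ ^ (δ - t) / κ ^ (δ - t)) := by
            rw [e1, e2]
            field_simp
          rw [this]
          exact mul_le_of_le_one_right (by positivity) ((div_le_one (by positivity)).2 e3)

/-- A maximal family of leaves, among those that respect the growth condition with constant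
`2 * K ^ 2`, saturates: every leaf outside the family is prevented from joining by a ball that
already carries mass `K ^ 2 * ρ ^ t`; that ball is not smaller than half the leaf, because the
leaves are well separated. Members of the family saturate themselves. -/
theorem AhlforsBounds.exists_saturated_family [OpensMeasurableSpace Y] (h : AhlforsBounds δ K μ)
    {t : ℝ} (ht : 0 ≤ t) (htδ : t ≤ δ) (u : Set Y) (κ : Y → ℝ) (hκ : ∀ y ∈ u, 0 < κ y)
    (hκd : ∀ y ∈ u, κ y ≤ Metric.diam (univ : Set Y))
    (hdisj : u.PairwiseDisjoint fun y => Metric.closedBall y (3 * κ y)) :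
    ∃ S ⊆ u, (∀ T : Finset Y, ↑T ⊆ S → ∀ x ρ, 0 < ρ →
        ∑ y ∈ T, spreadMeasure μ t y (κ y) (Metric.ball x ρ) ≤
          ENNReal.ofReal (2 * K ^ 2 * ρ ^ t)) ∧
      ∀ y ∈ u, ∃ x ρ, 0 < ρ ∧ κ y ≤ 2 * ρ ∧ dist y x < ρ + κ y ∧
        ∃ T : Finset Y, ↑T ⊆ S ∧ ENNReal.ofReal (ρ ^ t) ≤
          ∑ z ∈ T, spreadMeasure μ t z (κ z) (Metric.ball x ρ) := by
  classical
  have hK : 0 < K := one_pos.trans_le h.one_le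
  let 𝓕 : Set (Set Y) := {S | S ⊆ u ∧ ∀ T : Finset Y, ↑T ⊆ S → ∀ x ρ, 0 < ρ →
    ∑ y ∈ T, spreadMeasure μ t y (κ y) (Metric.ball x ρ) ≤ ENNReal.ofReal (2 * K ^ 2 * ρ ^ t)}
  have hchar : Order.IsOfFiniteCharacter 𝓕 := by
    intro S
    constructor
    · exact fun hS S' hS' _ => ⟨hS'.trans hS.1, fun T hT => hS.2 T (hT.trans hS')⟩
    · refine fun hS => ⟨fun y hy => ?_, fun T hT => ?_⟩
      · exact (hS {y} (singleton_subset_iff.2 hy) (finite_singleton y)).1 rfl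
      · exact (hS T hT T.finite_toSet).2 T subset_rfl
  have hempty : (∅ : Set Y) ∈ 𝓕 := by
    refine ⟨empty_subset _, fun T hT x ρ _ => ?_⟩
    have : T = ∅ := by simpa using hT
    simp [this]
  obtain ⟨S, -, hS⟩ := hchar.exists_maximal hempty
  refine ⟨S, hS.prop.1, hS.prop.2, fun y hy => ?_⟩
  have hκy := hκ y hy
  by_cases hyS : y ∈ S
  · refine ⟨y, κ y, hκy, by linarith, by simpa using hκy, {y}, by simpa using hyS, ?_⟩
    rw [Finset.sum_singleton, ← h.spreadMeasure_univ t y hκy (hκd y hy)]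
    rw [← measure_add_measure_compl (measurableSet_ball (x := y) (ε := κ y)),
      spreadMeasure_eq_zero t disjoint_compl_left, add_zero]
  have hins : insert y S ∉ 𝓕 := fun hin =>
    hyS (hS.le_of_ge hin (subset_insert y S) (mem_insert y S))
  have : ∃ T : Finset Y, ↑T ⊆ insert y S ∧ ∃ x ρ, 0 < ρ ∧ ENNReal.ofReal (2 * K ^ 2 * ρ ^ t) <
      ∑ z ∈ T, spreadMeasure μ t z (κ z) (Metric.ball x ρ) := by
    by_contra! hcon
    exact hins ⟨insert_subset hy hS.prop.1, fun T hT x ρ hρ => hcon T hT x ρ hρ⟩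
  obtain ⟨T, hT, x, ρ, hρ, hlt⟩ := this
  have hTS : ↑(T.erase y) ⊆ S := by
    intro z hz
    rw [Finset.mem_coe, Finset.mem_erase] at hz
    exact (hT hz.2).resolve_left hz.1
  have hyT : y ∈ T := by
    by_contra hyT
    rw [Finset.erase_eq_of_notMem hyT] at hTS
    exact absurd (hS.prop.2 T hTS x ρ hρ) (not_le.2 hlt)
  rw [← Finset.add_sum_erase _ _ hyT] at hlt
  have hsum : ENNReal.ofReal (K ^ 2 * ρ ^ t) ≤
      ∑ z ∈ T.erase y, spreadMeasure μ t z (κ z) (Metric.ball x ρ) := by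
    by_contra! hcon
    have := ENNReal.add_lt_add_of_le_of_lt
      (ne_top_of_le_ne_top ENNReal.ofReal_ne_top
        (h.spreadMeasure_ball_le ht htδ y hκy (hκd y hy) x hρ))
      (h.spreadMeasure_ball_le ht htδ y hκy (hκd y hy) x hρ) hcon
    rw [← ENNReal.ofReal_add (by positivity) (by positivity)] at this
    refine absurd (hlt.trans this) (not_lt.2 (le_of_eq ?_))
    ring_nf
  have hyx : dist y x < ρ + κ y := by
    by_contra! hcon
    have : spreadMeasure μ t y (κ y) (Metric.ball x ρ) = 0 := by
      refine spreadMeasure_eq_zero t (Metric.ball_disjoint_ball ?_)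
      rw [dist_comm]
      exact hcon
    rw [this, zero_add] at hlt
    exact absurd (hS.prop.2 _ hTS x ρ hρ) (not_le.2 hlt)
  have hρκ : κ y ≤ 2 * ρ := by
    by_contra! hcon
    -- a smaller ball would lie in `B(y, 2κ)`, which no other leaf meets
    have hz : ∀ z ∈ T.erase y, spreadMeasure μ t z (κ z) (Metric.ball x ρ) = 0 := by
      intro z hz
      refine spreadMeasure_eq_zero t ?_
      have hzu : z ∈ u := hS.prop.1 (hTS hz)
      refine (hdisj hy hzu (Finset.ne_of_mem_erase hz).symm).mono ?_ ?_
      · intro w hw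
        rw [Metric.mem_ball] at hw
        rw [Metric.mem_closedBall]
        have := dist_triangle w x y
        rw [dist_comm x y] at this
        linarith
      · refine Metric.ball_subset_closedBall.trans (Metric.closedBall_subset_closedBall ?_)
        linarith [hκ z hzu]
    rw [Finset.sum_eq_zero hz, nonpos_iff_eq_zero, ENNReal.ofReal_eq_zero] at hsum
    have : 0 < K ^ 2 * ρ ^ t := by positivity
    linarith
  refine ⟨x, ρ, hρ, hρκ, hyx, T.erase y, hTS, le_trans (ENNReal.ofReal_le_ofReal ?_) hsum⟩
  exact le_mul_of_one_le_left (by positivity) (one_le_pow₀ h.one_le)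

/-- If every point of `V` is close to a ball `B(x, ρ)` of mass at least `ρ ^ t` for a finite
sub-family of the measures `m z`, then finitely many of the measures have a total mass comparable
to the content of `V`. -/
theorem exists_finset_le_sum_univ [CompactSpace Y] [OpensMeasurableSpace Y] {ι : Type*}
    {t : ℝ} {S : Set Y} {m : Y → Measure Y}
    {V : Set Y} {a R : ℝ} (ha : 0 < a) (hV : ENNReal.ofReal a ≤ radiusContent t V)
    (u : Set ι) (x : ι → Y) (ρ : ι → ℝ) (T : ι → Finset Y) (hρ : ∀ i ∈ u, 0 < ρ i)
    (hρR : ∀ i ∈ u, ρ i ≤ R) (hTS : ∀ i ∈ u, ↑(T i) ⊆ S)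
    (hmass : ∀ i ∈ u, ENNReal.ofReal (ρ i ^ t) ≤ ∑ z ∈ T i, m z (Metric.ball (x i) (ρ i)))
    (hcov : ∀ y ∈ V, ∃ i ∈ u, y ∈ Metric.closedBall (x i) (33 * ρ i)) :
    ∃ T : Finset Y, ↑T ⊆ S ∧ ENNReal.ofReal (a / (2 * 166 ^ t)) ≤ ∑ z ∈ T, m z univ := by
  classical
  obtain ⟨w, hwu, hdisj, hw⟩ := Vitali.exists_disjoint_subfamily_covering_enlargement_closedBall
    u x (fun i => 33 * ρ i) (33 * R) (fun i hi => by have := hρR i hi; linarith) 5 (by norm_num)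
  have hdisj' : w.PairwiseDisjoint fun i => Metric.ball (x i) (ρ i) := by
    refine hdisj.mono_on fun i hi => ?_
    refine Metric.ball_subset_closedBall.trans (Metric.closedBall_subset_closedBall ?_)
    linarith [hρ i (hwu hi)]
  have hcount : w.Countable := hdisj'.countable_of_isOpen (fun _ _ => Metric.isOpen_ball)
    (fun i hi => ⟨x i, Metric.mem_ball_self (hρ i (hwu hi))⟩)
  have := hcount.to_subtype
  have hsum : ENNReal.ofReal a ≤ ∑' i : w, ENNReal.ofReal ((166 * ρ i) ^ t) := by
    refine hV.trans (radiusContent_le_tsum (fun i : w => x i) _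
      (fun i => mul_pos (by norm_num) (hρ i (hwu i.2))) fun y hy => ?_)
    obtain ⟨i, hi, hyi⟩ := hcov y hy
    obtain ⟨j, hj, hij⟩ := hw i hi
    refine mem_iUnion.2 ⟨⟨j, hj⟩, Metric.closedBall_subset_ball ?_ (hij hyi)⟩
    linarith [hρ j (hwu hj)]
  have hlt : ENNReal.ofReal (a / 2) < ∑' i : w, ENNReal.ofReal ((166 * ρ i) ^ t) :=
    ((ENNReal.ofReal_lt_ofReal_iff ha).2 (by linarith)).trans_le hsum
  rw [ENNReal.tsum_eq_iSup_sum, lt_iSup_iff] at hlt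
  obtain ⟨W, hW⟩ := hlt
  have hWd : (W : Set w).PairwiseDisjoint fun i => Metric.ball (x i) (ρ i) :=
    fun i _ j _ hij => hdisj' i.2 j.2 (Subtype.coe_injective.ne hij)
  refine ⟨W.biUnion fun i => T i, ?_, ?_⟩
  · rw [Finset.coe_biUnion]
    exact iUnion₂_subset fun i _ => hTS i (hwu i.2)
  · have h166 : (0 : ℝ) < 166 ^ t := by positivity
    have e1 : ENNReal.ofReal (a / (2 * 166 ^ t)) ≤ ∑ i ∈ W, ENNReal.ofReal (ρ i ^ t) := by
      have : ∑ i ∈ W, ENNReal.ofReal ((166 * ρ i) ^ t) =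
          ENNReal.ofReal (166 ^ t) * ∑ i ∈ W, ENNReal.ofReal (ρ i ^ t) := by
        rw [Finset.mul_sum]
        refine Finset.sum_congr rfl fun i _ => ?_
        rw [Real.mul_rpow (by norm_num) (hρ i (hwu i.2)).le, ENNReal.ofReal_mul h166.le]
      rw [this] at hW
      rw [← div_div, ENNReal.ofReal_div_of_pos h166]
      exact ENNReal.div_le_of_le_mul' hW.le
    calc ENNReal.ofReal (a / (2 * 166 ^ t)) ≤ ∑ i ∈ W, ENNReal.ofReal (ρ i ^ t) := e1
      _ ≤ ∑ i ∈ W, ∑ z ∈ W.biUnion fun i => T i, m z (Metric.ball (x i) (ρ i)) := by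
          refine Finset.sum_le_sum fun i hi => (hmass i (hwu i.2)).trans ?_
          exact Finset.sum_le_sum_of_subset (Finset.subset_biUnion_of_mem (fun i : w => T i) hi)
      _ = ∑ z ∈ W.biUnion fun i => T i, ∑ i ∈ W, m z (Metric.ball (x i) (ρ i)) :=
          Finset.sum_comm
      _ ≤ ∑ z ∈ W.biUnion fun i => T i, m z univ := by
          refine Finset.sum_le_sum fun z _ => ?_
          rw [← measure_biUnion_finset hWd fun _ _ => measurableSet_ball]
          exact measure_mono (subset_univ _)

/-- **Frostman's lemma** for open sets, with measures of bounded density. The measure lives on a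
closed subset of `V`, and its growth constant is inversely proportional to the content of `V`. -/
theorem AhlforsBounds.exists_frostman [CompactSpace Y] [OpensMeasurableSpace Y]
    (h : AhlforsBounds δ K μ) {t : ℝ} (ht : 0 < t) (htδ : t ≤ δ) :
    ∃ C : ℝ, 0 < C ∧ ∀ V : Set Y, IsOpen V → ∀ a : ℝ, 0 < a →
      ENNReal.ofReal a ≤ radiusContent t V → ∃ (m : Measure Y) (M : ℝ≥0∞) (L : Set Y),
        IsProbabilityMeasure m ∧ M ≠ ∞ ∧ m ≤ M • μ ∧ IsClosed L ∧ L ⊆ V ∧ m Lᶜ = 0 ∧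
        ∀ x ρ, 0 < ρ → m (Metric.ball x ρ) ≤ ENNReal.ofReal (C / a * ρ ^ t) := by
  classical
  have hK : 0 < K := one_pos.trans_le h.one_le
  have hd := h.diam_pos
  set d := Metric.diam (univ : Set Y) with hdd
  refine ⟨2 * K ^ 2 * (2 * 166 ^ t), by positivity, fun V hVo a ha hV => ?_⟩
  -- leaves: small balls that stay inside `V`
  have hleaf : ∀ y : Y, ∃ κ : ℝ, 0 < κ ∧ κ ≤ d ∧ (y ∈ V → Metric.closedBall y κ ⊆ V) := by
    intro y
    by_cases hy : y ∈ V
    · obtain ⟨r, hr, hrV⟩ := Metric.nhds_basis_closedBall.mem_iff.1 (hVo.mem_nhds hy)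
      exact ⟨min r d, lt_min hr hd, min_le_right _ _, fun _ =>
        (Metric.closedBall_subset_closedBall (min_le_left _ _)).trans hrV⟩
    · exact ⟨d, hd, le_rfl, fun h => absurd h hy⟩
  choose κ hκ hκd hκV using hleaf
  obtain ⟨u, huV, hdisj, hcov⟩ := Vitali.exists_disjoint_subfamily_covering_enlargement_closedBall
    V id (fun y => 3 * κ y) (3 * d) (fun y _ => by have := hκd y; linarith) 5 (by norm_num)
  obtain ⟨S, hSu, hS, hsat⟩ := h.exists_saturated_family ht.le htδ u κ (fun y _ => hκ y)
    (fun y _ => hκd y) hdisj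
  choose! x ρ hρ hκρ hyx T hTS hT using hsat
  -- the radii of saturated balls are bounded since the total mass is
  have hρR : ∀ y ∈ u, ρ y ≤ (2 * K ^ 2 * (d + 1) ^ t) ^ t⁻¹ := by
    intro y hy
    have h1 : ENNReal.ofReal (ρ y ^ t) ≤ ENNReal.ofReal (2 * K ^ 2 * (d + 1) ^ t) := by
      refine (hT y hy).trans (le_trans (Finset.sum_le_sum fun z _ => measure_mono fun w _ => ?_)
        (hS (T y) (hTS y hy) y (d + 1) (by positivity)))
      have := Metric.dist_le_diam_of_mem isCompact_univ.isBounded (mem_univ w) (mem_univ y)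
      rw [Metric.mem_ball]
      linarith
    rw [ENNReal.ofReal_le_ofReal_iff (by positivity)] at h1
    exact (Real.le_rpow_inv_iff_of_pos (hρ y hy).le (by positivity) ht).2 h1
  obtain ⟨W, hWS, hW⟩ := exists_finset_le_sum_univ ha hV u x ρ T hρ hρR hTS hT (by
    intro y hy
    obtain ⟨b, hb, hyb⟩ := hcov y hy
    refine ⟨b, hb, ?_⟩
    have h1 := hyb (Metric.mem_closedBall_self (by linarith [hκ y]))
    have h2 := hyx b hb
    have h3 := hκρ b hb
    rw [Metric.mem_closedBall] at h1 ⊢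
    have := dist_triangle y b (x b)
    simp only [id] at h1
    linarith)
  -- normalise the sum of the finitely many leaves `W`
  set I : ℝ≥0∞ := ∑ z ∈ W, spreadMeasure μ t z (κ z) univ with hI
  have hpos : 0 < a / (2 * 166 ^ t) := by positivity
  have hI0 : I ≠ 0 := ((ENNReal.ofReal_pos.2 hpos).trans_le hW).ne'
  have hItop : I ≠ ∞ := by
    rw [hI]
    refine ENNReal.sum_ne_top.2 fun z _ => ?_
    rw [h.spreadMeasure_univ t z (hκ z) (hκd z)]
    exact ENNReal.ofReal_ne_top
  refine ⟨I⁻¹ • ∑ z ∈ W, spreadMeasure μ t z (κ z),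
    I⁻¹ * ∑ z ∈ W, ENNReal.ofReal (κ z ^ t) / μ (Metric.ball z (κ z)),
    ⋃ z ∈ W, Metric.closedBall z (κ z), ⟨?_⟩, ?_, ?_, ?_, ?_, ?_, ?_⟩
  · rw [Measure.smul_apply, Measure.finsetSum_apply, smul_eq_mul]
    exact ENNReal.inv_mul_cancel hI0 hItop
  · refine ENNReal.mul_ne_top (ENNReal.inv_ne_top.2 hI0) (ENNReal.sum_ne_top.2 fun z _ => ?_)
    exact ENNReal.div_ne_top ENNReal.ofReal_ne_top (h.measure_ball_ne_zero z (hκ z) (hκd z))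
  · rw [mul_smul, Finset.sum_smul]
    intro A
    simp only [Measure.smul_apply, Measure.finsetSum_apply, smul_eq_mul]
    gcongr with z hz
    exact spreadMeasure_le t z (κ z) A
  · exact isClosed_biUnion_finset fun z _ => Metric.isClosed_closedBall
  · exact iUnion₂_subset fun z hz => hκV z (huV (hSu (hWS hz)))
  · rw [Measure.smul_apply, Measure.finsetSum_apply, Finset.sum_eq_zero, smul_zero]
    intro z hz
    refine spreadMeasure_eq_zero t (disjoint_compl_left_iff_subset.2 ?_)
    exact Metric.ball_subset_closedBall.trans
      (subset_biUnion_of_mem (u := fun z => Metric.closedBall z (κ z)) hz)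
  · intro y r hr
    rw [Measure.smul_apply, Measure.finsetSum_apply, smul_eq_mul]
    calc I⁻¹ * ∑ z ∈ W, spreadMeasure μ t z (κ z) (Metric.ball y r)
        ≤ (ENNReal.ofReal (a / (2 * 166 ^ t)))⁻¹ * ENNReal.ofReal (2 * K ^ 2 * r ^ t) := by
          gcongr
          exact hS W hWS y r hr
      _ = _ := by
          rw [← ENNReal.ofReal_inv_of_pos hpos, ← ENNReal.ofReal_mul (by positivity)]
          congr 1
          field_simp

end Frostman

/-! ### Content of the open sets near the sets of the self-conformal family -/

section SelfConformal

variable {Y : Type*} [MetricSpace Y] [MeasurableSpace Y] {ν : Measure Y}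

theorem measure_ball_le_of_lt_log_div [IsProbabilityMeasure ν] {x : Y} {a r : ℝ} (hr : 0 < r)
    (hr1 : r < 1)
    (h : (a : EReal) < ENNReal.log (ν (Metric.ball x r)) / (Real.log r : EReal)) :
    ν (Metric.ball x r) ≤ ENNReal.ofReal (r ^ a) := by
  by_cases h0 : ν (Metric.ball x r) = 0
  · simp [h0]
  have htop : ν (Metric.ball x r) ≠ ∞ := measure_ne_top _ _
  have hlog : Real.log r < 0 := Real.log_neg hr hr1
  rw [ENNReal.log_pos_real h0 htop, ← EReal.coe_div, EReal.coe_lt_coe_iff,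
    lt_div_iff_of_neg hlog] at h
  have hpos : 0 < (ν (Metric.ball x r)).toReal := ENNReal.toReal_pos h0 htop
  rw [← ENNReal.ofReal_toReal htop]
  apply ENNReal.ofReal_le_ofReal
  rw [Real.rpow_def_of_pos hr, ← Real.log_le_iff_le_exp hpos]
  linarith

/-- Below the upper Hausdorff dimension, the measure of small balls decays with uniform exponent on
a closed set of positive measure. The factor `2` pays for passing to the closure. -/
theorem exists_isClosed_measure_ball_le [IsProbabilityMeasure ν] {a : ℝ}
    (h : (a : EReal) < upperHausdorffDim ν) :
    ∃ G : Set Y, IsClosed G ∧ ν G ≠ 0 ∧ ∃ r₀ : ℝ, 0 < r₀ ∧ ∀ x ∈ G, ∀ r, 0 < r → r < r₀ →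
      ν (Metric.ball x r) ≤ ENNReal.ofReal ((2 * r) ^ a) := by
  let G : ℕ → Set Y := fun k => {x | ∀ r : ℝ, 0 < r → r < 1 / ((k : ℝ) + 1) →
    ν (Metric.ball x r) ≤ ENNReal.ofReal (r ^ a)}
  have hG : {x | (a : EReal) < lowerLocalDim ν x} ⊆ ⋃ k, G k := by
    intro x hx
    have h1 : ∀ᶠ r : ℝ in 𝓝[>] 0,
        (a : EReal) < ENNReal.log (ν (Metric.ball x r)) / (Real.log r : EReal) :=
      eventually_lt_of_lt_liminf hx
    obtain ⟨ε, hε, hε'⟩ := (mem_nhdsGT_iff_exists_Ioo_subset).1 h1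
    obtain ⟨k, hk⟩ := exists_nat_one_div_lt (mem_Ioi.1 hε)
    refine mem_iUnion.2 ⟨k, fun r hr hrk => measure_ball_le_of_lt_log_div hr ?_
      (hε' ⟨hr, hrk.trans hk⟩)⟩
    refine hrk.trans_le ?_
    rw [div_le_one (by positivity)]
    linarith [(Nat.cast_nonneg k : (0 : ℝ) ≤ k)]
  have hpos : ν {x | (a : EReal) < lowerLocalDim ν x} ≠ 0 := by
    intro h0
    have hae : ∀ᵐ x ∂ν, lowerLocalDim ν x ≤ a := by
      rw [ae_iff]
      simpa using h0
    exact absurd (essSup_le_of_ae_le (f := lowerLocalDim ν) _ hae) (not_le.2 h)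
  have : ∃ k, ν (G k) ≠ 0 := by
    by_contra! hcon
    exact hpos (measure_mono_null hG (measure_iUnion_null hcon))
  obtain ⟨k, hk⟩ := this
  refine ⟨closure (G k), isClosed_closure,
    fun h0 => hk (measure_mono_null subset_closure h0), 1 / ((k : ℝ) + 1) / 2, by positivity, ?_⟩
  intro x hx r hr hrk
  obtain ⟨y, hy, hxy⟩ := Metric.mem_closure_iff.1 hx r hr
  refine (measure_mono fun z hz => ?_).trans (hy (2 * r) (by positivity) (by linarith))
  rw [Metric.mem_ball] at hz ⊢
  linarith [dist_triangle z x y]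

/-- Transport of the decay of `ν` near `G` to every `F i`: a fixed proportion of the mass of `F i`
lies in a set on which `ν` decays with exponent `a`, at scale `|F i|`, with uniform constants. -/
theorem IsQuasiSelfConformal.exists_decay [BorelSpace Y] {ι : Type*} {F : ι → Set Y}
    (hν : IsQuasiSelfConformal ν F) (hdiam : 0 < Metric.diam (univ : Set Y)) {a : ℝ} (ha : 0 ≤ a)
    (h : (a : EReal) < upperHausdorffDim ν) :
    ∃ c C : ℝ, 0 < c ∧ 1 ≤ C ∧ ∀ i, 0 < Metric.diam (F i) ∧ ν (F i) ≠ 0 ∧ ∃ H ⊆ F i,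
      ENNReal.ofReal c * ν (F i) ≤ ν H ∧ ∀ z ρ, 0 < ρ → ν (Metric.ball z ρ ∩ H) ≤
        ENNReal.ofReal (C * (ρ / Metric.diam (F i)) ^ a) * ν (F i) := by
  have := hν.isProbabilityMeasure
  obtain ⟨G, hGc, hG0, r₀, hr₀, hG⟩ := exists_isClosed_measure_ball_le h
  obtain ⟨C, hC, hmaps⟩ := hν.exists_maps
  have hC0 : 0 < C := one_pos.trans_le hC
  have hGpos : 0 < (ν G).toReal := ENNReal.toReal_pos hG0 (measure_ne_top _ _)
  refine ⟨C⁻¹ * (ν G).toReal,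
    max 1 (max (C * (2 * (C * 2)) ^ a) ((C * 2 / r₀) ^ a)), by positivity, le_max_left _ _,
    fun i => ?_⟩
  obtain ⟨f, hf, hdist, hmeas⟩ := hmaps i
  have hR : 0 < Metric.diam (F i) := by
    refine Metric.diam_nonneg.lt_of_ne fun h0 => hdiam.ne' ?_
    refine Metric.diam_subsingleton fun x _ y _ => ?_
    obtain ⟨p, rfl⟩ := hf.2 x
    obtain ⟨q, rfl⟩ := hf.2 y
    have := (hdist p q).2
    rw [← h0, div_zero, mul_zero] at this
    exact dist_le_zero.1 this
  set R := Metric.diam (F i)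
  have hF0 : ν (F i) ≠ 0 := by
    intro h0
    have h1 : ν (Subtype.val '' (f ⁻¹' univ)) = 0 :=
      measure_mono_null (by simp) h0
    have h2 := (hmeas univ MeasurableSet.univ).1
    rw [h1, ENNReal.zero_div, measure_univ, mul_one, nonpos_iff_eq_zero,
      ENNReal.ofReal_eq_zero] at h2
    exact absurd h2 (not_le.2 (by positivity))
  have hFtop : ν (F i) ≠ ∞ := measure_ne_top _ _
  refine ⟨hR, hF0, Subtype.val '' (f ⁻¹' G), by simp, ?_, ?_⟩
  · have := (hmeas G hGc.measurableSet).1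
    rw [ENNReal.ofReal_mul (by positivity), ENNReal.ofReal_toReal (measure_ne_top _ _)]
    rwa [ENNReal.le_div_iff_mul_le (Or.inl hF0) (Or.inl hFtop)] at this
  · intro z ρ hρ
    rcases (Metric.ball z ρ ∩ Subtype.val '' (f ⁻¹' G)).eq_empty_or_nonempty with he | hne
    · simp [he]
    obtain ⟨_, hz, y, hy, rfl⟩ := hne
    set σ : ℝ := C * (2 * ρ / R) with hσ
    have hσ0 : 0 < σ := by positivity
    rcases lt_or_ge σ r₀ with hσr | hσr
    · have hsub : Metric.ball z ρ ∩ Subtype.val '' (f ⁻¹' G) ⊆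
          Subtype.val '' (f ⁻¹' Metric.ball (f y) σ) := by
        rintro _ ⟨hw, w, -, rfl⟩
        refine ⟨w, ?_, rfl⟩
        rw [mem_preimage, Metric.mem_ball]
        refine (hdist w y).2.trans_lt ?_
        rw [Metric.mem_ball] at hz hw
        have : dist w y < 2 * ρ := by
          rw [Subtype.dist_eq]
          linarith [dist_triangle_right (w : Y) y z]
        rw [hσ]
        gcongr
      have h1 := (hmeas _ (measurableSet_ball (x := f y) (ε := σ))).2
      rw [ENNReal.div_le_iff hF0 hFtop] at h1
      refine (measure_mono hsub).trans (h1.trans ?_)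
      gcongr
      refine (mul_le_mul_right (hG _ hy σ hσ0 hσr) _).trans ?_
      rw [← ENNReal.ofReal_mul hC0.le]
      apply ENNReal.ofReal_le_ofReal
      calc C * (2 * σ) ^ a = C * (2 * (C * 2)) ^ a * (ρ / R) ^ a := by
            rw [mul_assoc, ← Real.mul_rpow (by positivity) (by positivity), hσ]
            congr 2
            ring
        _ ≤ _ := by
            gcongr
            exact (le_max_left _ _).trans (le_max_right _ _)
    · refine (measure_mono (inter_subset_right.trans (by simp : _ ⊆ F i))).trans
        (le_mul_of_one_le_left' (ENNReal.one_le_ofReal.2 ?_))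
      calc (1 : ℝ) ≤ (C * 2 / r₀ * (ρ / R)) ^ a := by
            refine Real.one_le_rpow ?_ ha
            have : C * 2 / r₀ * (ρ / R) = σ / r₀ := by rw [hσ]; ring
            rw [this]
            exact (one_le_div hr₀).2 hσr
        _ = (C * 2 / r₀) ^ a * (ρ / R) ^ a := Real.mul_rpow (by positivity) (by positivity)
        _ ≤ _ := by
            gcongr
            exact (le_max_right _ _).trans (le_max_right _ _)

/-- Near a set `F` of diameter `R` with a well-decaying portion `H`, the union of the tails of the
sets `E n` has content at least a fixed multiple of `R ^ t`.

In a cover, the balls `B(x n, r n)` that meet `H` are of two kinds. Either `E n` meets a member of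
the cover with radius at least `r n`, so that `B(x n, r n)` is inside a multiple of that member; or
`E n` is covered by members with radii below `r n`, whose total cost pays for the mass of a multiple
of `B(x n, r n)` because of the content of `E n`. Both kinds together cover `H`. -/
theorem le_radiusContent_inter_thickening [OpensMeasurableSpace Y] [IsProbabilityMeasure ν]
    {c C a t s D c' R κ : ℝ} (hc : 0 < c) (hC : 1 ≤ C) (ht : 0 ≤ t) (hta : t ≤ a)
    (hts : t ≤ s) (hDa : D + t - s < a) (hc' : 0 < c') (hR : 0 < R) (hκ : 0 < κ) {F H : Set Y}
    (hF0 : ν F ≠ 0) (hHF : H ⊆ F) (hH : ENNReal.ofReal c * ν F ≤ ν H)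
    (hdecay : ∀ z ρ, 0 < ρ → ν (Metric.ball z ρ ∩ H) ≤ ENNReal.ofReal (C * (ρ / R) ^ a) * ν F)
    {x : ℕ → Y} {r : ℕ → ℝ} (hr : ∀ n, 0 < r n) (hr0 : Tendsto r atTop (𝓝 0)) {E : ℕ → Set Y}
    (hEB : ∀ n, E n ⊆ Metric.ball (x n) (r n))
    (hB : ν (limsup (fun n => Metric.ball (x n) (r n)) atTop) = 1)
    (hE : ∀ n, ENNReal.ofReal (c' * r n ^ D) ≤ radiusContent s (E n)) (N : ℕ) :
    ENNReal.ofReal (c / (C * (3 ^ t + 1)) * R ^ t) ≤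
      radiusContent t ((⋃ n ≥ N, E n) ∩ Metric.thickening κ F) := by
  have hC0 : 0 < C := one_pos.trans_le hC
  have hFtop : ν F ≠ ∞ := measure_ne_top _ _
  have ha : 0 ≤ a := ht.trans hta
  refine le_radiusContent fun 𝓑 h𝓑 hpos hcov => ?_
  set cost : Y × ℝ → ℝ≥0∞ := fun b => ENNReal.ofReal (b.2 ^ t) with hcost
  have hdecay_t : ∀ z ρ, 0 < ρ →
      ν (Metric.ball z ρ ∩ H) ≤ ENNReal.ofReal (C * (ρ / R) ^ t) * ν F := by
    intro z ρ hρ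
    rcases le_or_gt (ρ / R) 1 with h1 | h1
    · refine (hdecay z ρ hρ).trans ?_
      gcongr ENNReal.ofReal (C * ?_) * _
      exact Real.rpow_le_rpow_of_exponent_ge (by positivity) h1 hta
    · refine (measure_mono (inter_subset_right.trans hHF)).trans
        (le_mul_of_one_le_left' (ENNReal.one_le_ofReal.2 ?_))
      exact one_le_mul_of_one_le_of_one_le hC (Real.one_le_rpow h1.le ht)
  -- the gap `a - (D + t - s)` makes the content of `E n` dominate the mass of `B(x n, r n)`
  have hsmall : ∀ᶠ n in atTop, r n < κ / 2 ∧
      (11 * r n / R) ^ a ≤ R ^ (-t) * (c' * r n ^ (D + t - s)) := by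
    refine (hr0.eventually_lt_const (by positivity)).and ?_
    have hlim : Tendsto (fun n => (11 / R) ^ a * r n ^ (a - (D + t - s))) atTop (𝓝 0) := by
      have h1 := (Real.continuousAt_rpow_const 0 (a - (D + t - s)) (Or.inr (by linarith))).tendsto
      rw [Real.zero_rpow (by linarith)] at h1
      simpa using (h1.comp hr0).const_mul ((11 / R) ^ a)
    filter_upwards [hlim.eventually_lt_const (show 0 < R ^ (-t) * c' by positivity)] with n hn
    have h2 : (11 * r n / R) ^ a =
        (11 / R) ^ a * r n ^ (a - (D + t - s)) * r n ^ (D + t - s) := by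
      rw [mul_assoc, ← Real.rpow_add (hr n), sub_add_cancel,
        ← Real.mul_rpow (by positivity) (hr n).le]
      congr 1
      ring
    rw [h2, ← mul_assoc]
    gcongr
    exact (Real.rpow_pos_of_pos (hr n) _).le
  obtain ⟨N', hN'⟩ := eventually_atTop.1 (hsmall.and (eventually_ge_atTop N))
  let I : Set ℕ := {n | N' ≤ n ∧ (Metric.ball (x n) (r n) ∩ H).Nonempty}
  let 𝓑' : ℕ → Set (Y × ℝ) := fun n => {b ∈ 𝓑 | (Metric.ball b.1 b.2 ∩ E n).Nonempty}
  let J₀ : Set ℕ := {n ∈ I | ∀ b ∈ 𝓑' n, b.2 < r n}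
  have hJκ : ∀ n ∈ J₀, 2 * r n ≤ κ := fun n hn => by linarith [(hN' n hn.1.1).1.1]
  obtain ⟨J, hJ, hdisj, hJcov⟩ := Vitali.exists_disjoint_subfamily_covering_enlargement_closedBall
    J₀ x (fun n => 2 * r n) κ hJκ 5 (by norm_num)
  have hEcov : ∀ n ∈ I, E n ⊆ ⋃ b ∈ 𝓑' n, Metric.ball b.1 b.2 := by
    intro n hn z hz
    obtain ⟨y, hyB, hyH⟩ := hn.2
    have hzB := hEB n hz
    have hmem : z ∈ (⋃ n ≥ N, E n) ∩ Metric.thickening κ F := by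
      refine ⟨mem_iUnion₂.2 ⟨n, (hN' n hn.1).2, hz⟩, Metric.mem_thickening_iff.2 ⟨y, hHF hyH, ?_⟩⟩
      rw [Metric.mem_ball] at hyB hzB
      linarith [dist_triangle_right z y (x n), (hN' n hn.1).1.1]
    obtain ⟨b, hb, hzb⟩ := mem_iUnion₂.1 (hcov hmem)
    exact mem_iUnion₂.2 ⟨b, ⟨hb, z, hzb, hz⟩, hzb⟩
  have hcenter : ∀ n ∈ J₀, ∀ b ∈ 𝓑' n, b.1 ∈ Metric.closedBall (x n) (2 * r n) := by
    rintro n hn b hb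
    have h1 := hn.2 b hb
    obtain ⟨-, z, hzb, hz⟩ := hb
    have hzB := hEB n hz
    rw [Metric.mem_ball] at hzb hzB
    rw [Metric.mem_closedBall]
    linarith [dist_triangle_left b.1 (x n) z]
  have hsecond : ∀ n ∈ J₀, ν (Metric.ball (x n) (11 * r n) ∩ H) ≤
      ENNReal.ofReal (C * R ^ (-t)) * ν F * ∑' b : 𝓑' n, cost b := by
    intro n hn
    have hrn := hr n
    have h1 : ENNReal.ofReal (c' * r n ^ D) ≤
        ENNReal.ofReal (r n ^ (s - t)) * ∑' b : 𝓑' n, cost b := by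
      refine (hE n).trans ((radiusContent_le _ (h𝓑.mono fun b hb => hb.1)
        (fun b hb => hpos b hb.1) (hEcov n hn.1)).trans ?_)
      rw [← ENNReal.tsum_mul_left]
      refine ENNReal.tsum_le_tsum fun b => ?_
      have hb := hpos b b.2.1
      rw [hcost, ← ENNReal.ofReal_mul (by positivity)]
      apply ENNReal.ofReal_le_ofReal
      calc b.1.2 ^ s = b.1.2 ^ (s - t) * b.1.2 ^ t := by
            rw [← Real.rpow_add hb, sub_add_cancel]
        _ ≤ _ := by
            gcongr
            exact (hn.2 b b.2).le
    have h2 : ENNReal.ofReal (c' * r n ^ (D + t - s)) ≤ ∑' b : 𝓑' n, cost b := by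
      have h3 : c' * r n ^ (D + t - s) = c' * r n ^ D / r n ^ (s - t) := by
        rw [mul_div_assoc, ← Real.rpow_sub hrn]
        congr 2
        ring
      rw [h3, ENNReal.ofReal_div_of_pos (by positivity)]
      exact ENNReal.div_le_of_le_mul' h1
    calc ν (Metric.ball (x n) (11 * r n) ∩ H)
        ≤ ENNReal.ofReal (C * (11 * r n / R) ^ a) * ν F := hdecay _ _ (by positivity)
      _ ≤ ENNReal.ofReal (C * R ^ (-t) * (c' * r n ^ (D + t - s))) * ν F := by
          gcongr ENNReal.ofReal ?_ * _
          rw [mul_assoc]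
          gcongr
          exact (hN' n hn.1.1).1.2
      _ = ENNReal.ofReal (C * R ^ (-t)) * ν F * ENNReal.ofReal (c' * r n ^ (D + t - s)) := by
          rw [ENNReal.ofReal_mul (by positivity)]
          ring
      _ ≤ _ := by gcongr
  have hsum : ∑' n : J, ∑' b : 𝓑' n, cost b ≤ ∑' b : 𝓑, cost b := by
    rw [← ENNReal.tsum_sigma' (fun p : (n : J) × 𝓑' n => cost p.2)]
    refine ENNReal.tsum_comp_le_tsum_of_injective
      (f := fun p : (n : J) × 𝓑' n => (⟨p.2, p.2.2.1⟩ : 𝓑)) ?_ (fun b : 𝓑 => cost b)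
    rintro ⟨n, b, hb⟩ ⟨m, b', hb'⟩ heq
    obtain rfl : b = b' := congrArg Subtype.val heq
    have : n = m := by
      refine Subtype.ext (hdisj.elim_set n.2 m.2 b.1 ?_ ?_)
      · exact hcenter n (hJ n.2) b hb
      · exact hcenter m (hJ m.2) b hb'
    subst this
    rfl
  have hHcov : limsup (fun n => Metric.ball (x n) (r n)) atTop ∩ H ⊆
      (⋃ b ∈ 𝓑, Metric.ball b.1 (3 * b.2) ∩ H) ∪ ⋃ n ∈ J, Metric.ball (x n) (11 * r n) ∩ H := by
    rintro y ⟨hy, hyH⟩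
    rw [mem_limsup_iff_frequently_mem] at hy
    obtain ⟨n, hn, hyn⟩ := frequently_atTop.1 hy N'
    have hnI : n ∈ I := ⟨hn, y, hyn, hyH⟩
    by_cases hnJ : n ∈ J₀
    · right
      obtain ⟨m, hm, hnm⟩ := hJcov n hnJ
      refine mem_iUnion₂.2 ⟨m, hm, ?_, hyH⟩
      have h1 := hnm (Metric.ball_subset_closedBall.trans
        (Metric.closedBall_subset_closedBall (by linarith [hr n])) hyn)
      exact Metric.closedBall_subset_ball (by linarith [hr m]) h1
    · left
      have : ∃ b ∈ 𝓑' n, r n ≤ b.2 := by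
        by_contra! hcon
        exact hnJ ⟨hnI, hcon⟩
      obtain ⟨b, ⟨hb, z, hzb, hz⟩, hrb⟩ := this
      refine mem_iUnion₂.2 ⟨b, hb, ?_, hyH⟩
      have hzB := hEB n hz
      rw [Metric.mem_ball] at *
      linarith [dist_triangle4_right y b.1 (x n) z, dist_triangle_right y z (x n),
        dist_triangle y z b.1]
  have h𝓑c := h𝓑.to_subtype
  have hνH : ν H ≤ ENNReal.ofReal (C * (3 ^ t + 1) * R ^ (-t)) * ν F * ∑' b : 𝓑, cost b := by
    have hfull : ν (limsup (fun n => Metric.ball (x n) (r n)) atTop)ᶜ = 0 := by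
      rw [prob_compl_eq_zero_iff]
      · exact hB
      · exact MeasurableSet.measurableSet_limsup fun n => measurableSet_ball
    calc ν H = ν (limsup (fun n => Metric.ball (x n) (r n)) atTop ∩ H) := by
          rw [inter_comm, measure_inter_conull hfull]
      _ ≤ ν (⋃ b ∈ 𝓑, Metric.ball b.1 (3 * b.2) ∩ H) +
          ν (⋃ n ∈ J, Metric.ball (x n) (11 * r n) ∩ H) :=
          (measure_mono hHcov).trans (measure_union_le _ _)
      _ ≤ ∑' b : 𝓑, ν (Metric.ball b.1.1 (3 * b.1.2) ∩ H) +
          ∑' n : J, ν (Metric.ball (x n) (11 * r n) ∩ H) :=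
          add_le_add (measure_biUnion_le _ h𝓑 _) (measure_biUnion_le _ J.to_countable _)
      _ ≤ ∑' b : 𝓑, ENNReal.ofReal (C * 3 ^ t * R ^ (-t)) * ν F * cost b +
          ∑' n : J, ENNReal.ofReal (C * R ^ (-t)) * ν F * ∑' b : 𝓑' n, cost b := by
          refine add_le_add (ENNReal.tsum_le_tsum fun b => ?_)
            (ENNReal.tsum_le_tsum fun n => hsecond n (hJ n.2))
          have hb := hpos _ b.2
          refine (hdecay_t _ _ (by positivity)).trans (le_of_eq ?_)
          rw [hcost, mul_right_comm, ← ENNReal.ofReal_mul (by positivity)]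
          congr 2
          rw [Real.div_rpow (by positivity) hR.le, Real.mul_rpow (by norm_num) hb.le,
            Real.rpow_neg hR.le]
          ring
      _ ≤ ENNReal.ofReal (C * 3 ^ t * R ^ (-t)) * ν F * ∑' b : 𝓑, cost b +
          ENNReal.ofReal (C * R ^ (-t)) * ν F * ∑' b : 𝓑, cost b := by
          rw [ENNReal.tsum_mul_left, ENNReal.tsum_mul_left]
          gcongr
      _ = _ := by
          rw [← add_mul, ← add_mul, ← ENNReal.ofReal_add (by positivity) (by positivity)]
          congr 3
          ring
  have hfin : ENNReal.ofReal c ≤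
      ENNReal.ofReal (C * (3 ^ t + 1) * R ^ (-t)) * ∑' b : 𝓑, cost b := by
    have h1 := hH.trans hνH
    rw [mul_right_comm] at h1
    exact (ENNReal.mul_le_mul_iff_left hF0 hFtop).1 h1
  have hq : 0 < C * (3 ^ t + 1) * R ^ (-t) := by positivity
  have heq : c / (C * (3 ^ t + 1)) * R ^ t = c / (C * (3 ^ t + 1) * R ^ (-t)) := by
    rw [Real.rpow_neg hR.le]
    field_simp
  rw [heq, ENNReal.ofReal_div_of_pos hq]
  exact ENNReal.div_le_of_le_mul' hfin

end SelfConformal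

/-! ### Moving measures into an open set -/

section Dispersion

variable {Y : Type*} [MetricSpace Y] [MeasurableSpace Y] {δ K : ℝ} {μ : Measure Y}

/-- `m` has bounded density with respect to `μ`, is carried by `O`, and gives mass at most
`A * ρ ^ t` to every ball of radius `ρ`. -/
structure IsFrostmanOn (μ : Measure Y) (t A : ℝ) (O : Set Y) (m : Measure Y) : Prop where
  exists_le_smul : ∃ M : ℝ≥0∞, M ≠ ∞ ∧ m ≤ M • μ
  compl_eq_zero : m Oᶜ = 0
  ball_le : ∀ x ρ, 0 < ρ → m (Metric.ball x ρ) ≤ ENNReal.ofReal (A * ρ ^ t)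

theorem exists_rpow_le {p a b : ℝ} (hp : 0 < p) (hb : 0 < b) :
    ∃ η : ℝ, 0 < η ∧ a * η ^ p ≤ b := by
  have h1 := (Real.continuousAt_rpow_const 0 p (Or.inr hp.le)).tendsto
  rw [Real.zero_rpow hp.ne'] at h1
  have h2 : Tendsto (fun η : ℝ => a * η ^ p) (𝓝[>] 0) (𝓝 0) := by
    simpa using (h1.mono_left nhdsWithin_le_nhds).const_mul a
  obtain ⟨η, hη, hη0⟩ := ((h2.eventually_lt_const hb).and self_mem_nhdsWithin).exists
  exact ⟨η, hη0, hη.le⟩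

theorem exists_mul_one_add_rpow_le (A t : ℝ) {ε : ℝ} (hε : 0 < ε) :
    ∃ θ : ℝ, 0 < θ ∧ A * (1 + 17 * θ) ^ t ≤ A + ε := by
  have h1 : ContinuousAt (fun θ : ℝ => A * (1 + 17 * θ) ^ t) 0 := by
    refine ContinuousAt.mul continuousAt_const (ContinuousAt.rpow_const (by fun_prop) (Or.inl ?_))
    norm_num
  have h2 : Tendsto (fun θ : ℝ => A * (1 + 17 * θ) ^ t) (𝓝[>] 0) (𝓝 A) := by
    have := h1.tendsto.mono_left (nhdsWithin_le_nhds (s := Ioi 0))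
    simpa using this
  obtain ⟨θ, hθ, hθ0⟩ :=
    ((h2.eventually_lt_const (show A < A + ε by linarith)).and self_mem_nhdsWithin).exists
  exact ⟨θ, hθ0, hθ.le⟩

/-- Growth of a sum of redistributed pieces. The mass `m (P n)`, with `P n` inside
`B(y n, 15 * R n)`, is moved to `L n`, inside `B(y n, 2 * R n)`, according to `h n`. A ball of radius
`ρ` receives the pieces with `R n ≤ 2 * ρ` from a slightly larger ball; and since the balls
`B(y n, 3 * R n)` are disjoint, at most one piece with `R n > 2 * ρ` contributes. -/
theorem sum_redistributed_ball_le [OpensMeasurableSpace Y] {m : Measure Y} {h : ℕ → Measure Y}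
    (hprob : ∀ n, IsProbabilityMeasure (h n)) {y : ℕ → Y} {R : ℕ → ℝ} {P L : ℕ → Set Y}
    {u : Set ℕ} (hu : u.PairwiseDisjoint fun n => Metric.closedBall (y n) (3 * R n))
    (hPu : ∀ n ∉ u, P n = ∅) (hP : ∀ n ∈ u, P n ⊆ Metric.closedBall (y n) (15 * R n))
    (hPm : ∀ n, MeasurableSet (P n)) (hPd : Pairwise (Function.onFun Disjoint P))
    (hL : ∀ n, h n (L n)ᶜ = 0) (hLy : ∀ n, L n ⊆ Metric.closedBall (y n) (2 * R n))
    {η ρ : ℝ} (hη : ∀ n ∈ u, R n < η) (hρ : 0 < ρ) (x : Y) {B : ℝ≥0∞}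
    (hB : ∀ n ∈ u, m (P n) * h n (Metric.ball x ρ) ≤ B) (k : ℕ) :
    ∑ n ∈ Finset.range k, m (P n) * h n (Metric.ball x ρ) ≤
      m (Metric.ball x (ρ + 17 * min η (2 * ρ))) + B := by
  classical
  set ρ' := ρ + 17 * min η (2 * ρ) with hρ'
  have hmeet : ∀ n, h n (Metric.ball x ρ) ≠ 0 → (Metric.ball x ρ ∩ L n).Nonempty := by
    intro n hn
    rw [nonempty_iff_ne_empty]
    intro he
    refine hn (measure_mono_null ?_ (hL n))
    exact subset_compl_iff_disjoint_right.2 (disjoint_iff_inter_eq_empty.2 he)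
  rw [← Finset.sum_filter_add_sum_filter_not _ fun n => R n ≤ 2 * ρ]
  refine add_le_add ?_ ?_
  · calc ∑ n ∈ Finset.range k with R n ≤ 2 * ρ, m (P n) * h n (Metric.ball x ρ)
        ≤ ∑ n ∈ Finset.range k with R n ≤ 2 * ρ, m (P n ∩ Metric.ball x ρ') := by
          refine Finset.sum_le_sum fun n hn => ?_
          have hn2 : R n ≤ 2 * ρ := (Finset.mem_filter.1 hn).2
          by_cases hnu : n ∈ u
          swap
          · simp [hPu n hnu]
          by_cases h0 : h n (Metric.ball x ρ) = 0
          · simp [h0]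
          obtain ⟨z, hz, hzL⟩ := hmeet n h0
          have hsub : P n ⊆ Metric.ball x ρ' := by
            intro w hw
            have h1 := hP n hnu hw
            have h2 := hLy n hzL
            have h3 : R n ≤ min η (2 * ρ) := le_min (hη n hnu).le hn2
            rw [Metric.mem_closedBall] at h1 h2
            rw [Metric.mem_ball] at hz ⊢
            linarith [dist_triangle4_right w x (y n) z, dist_triangle w (y n) x,
              dist_triangle_left (y n) x z]
          rw [inter_eq_left.2 hsub]
          have := hprob n
          exact mul_le_of_le_one_right' prob_le_one
      _ = m (⋃ n ∈ (Finset.range k).filter fun n => R n ≤ 2 * ρ, P n ∩ Metric.ball x ρ') := by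
          rw [measure_biUnion_finset]
          · exact fun i _ j _ hij => (hPd hij).mono inter_subset_left inter_subset_left
          · exact fun n _ => (hPm n).inter measurableSet_ball
      _ ≤ m (Metric.ball x ρ') := measure_mono (iUnion₂_subset fun n _ => inter_subset_right)
  · by_cases hex : ∃ n ∈ (Finset.range k).filter (fun n => ¬ R n ≤ 2 * ρ),
        m (P n) * h n (Metric.ball x ρ) ≠ 0
    swap
    · rw [Finset.sum_eq_zero fun n hn => by_contra fun hne => hex ⟨n, hn, hne⟩]
      exact zero_le
    obtain ⟨n, hn, hn0⟩ := hex
    have hmem : ∀ i, m (P i) * h i (Metric.ball x ρ) ≠ 0 → i ∈ u := by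
      intro i hi
      by_contra hiu
      exact hi (by simp [hPu i hiu])
    rw [Finset.sum_eq_single_of_mem n hn]
    · exact hB n (hmem n hn0)
    intro i hi hin
    by_contra hi0
    refine hin ?_
    obtain ⟨z, hz, hzL⟩ := hmeet n (right_ne_zero_of_mul hn0)
    obtain ⟨w, hw, hwL⟩ := hmeet i (right_ne_zero_of_mul hi0)
    have hRn : 2 * ρ < R n := not_le.1 (Finset.mem_filter.1 hn).2
    have hRi : 2 * ρ < R i := not_le.1 (Finset.mem_filter.1 hi).2
    have h1 := hLy n hzL
    have h2 := hLy i hwL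
    refine hu.elim_set (hmem i hi0) (hmem n hn0) w
      (Metric.closedBall_subset_closedBall (by linarith) h2) ?_
    rw [Metric.mem_closedBall] at h1 ⊢
    rw [Metric.mem_ball] at hz hw
    linarith [dist_triangle w z (y n), dist_triangle_right w z x]

/-- The total mass and the growth constant of a measure of bounded density are almost kept when it
is moved into an open set `U` that has content at least `c * |F n| ^ t` near every `F n`. Since the
density is bounded and `t < δ`, the pieces at scale `η` carry mass about `η ^ δ`, much less than
`η ^ t`; this is why the constant `c` does not matter. -/
theorem IsFrostmanOn.exists_dispersion [CompactSpace Y] [BorelSpace Y] [IsProbabilityMeasure μ]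
    (hμ : AhlforsBounds δ K μ) {t A c ε : ℝ} (ht : 0 < t) (htδ : t < δ) (hA : 0 ≤ A) (hc : 0 < c)
    (hε : 0 < ε) {F : ℕ → Set Y} (hF0 : ∀ n, 0 < Metric.diam (F n))
    (hFlim : Tendsto (fun n => Metric.diam (F n)) atTop (𝓝 0))
    (hF : ∀ᵐ x ∂μ, ∃ᶠ n in atTop, x ∈ F n) {U O : Set Y} (hUo : IsOpen U) (hO : IsOpen O)
    (hU : ∀ n, ENNReal.ofReal (c * Metric.diam (F n) ^ t) ≤
      radiusContent t (U ∩ Metric.thickening (Metric.diam (F n)) (F n)))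
    {m : Measure Y} (hm : IsFrostmanOn μ t A O m) :
    ∃ m' O', IsOpen O' ∧ closure O' ⊆ U ∩ O ∧ IsFrostmanOn μ t (A + ε) O' m' ∧
      m univ ≤ m' univ + ENNReal.ofReal ε := by
  classical
  have hK : 0 < K := one_pos.trans_le hμ.one_le
  have hδ := hμ.dim_pos
  obtain ⟨M, hM, hmM⟩ := hm.exists_le_smul
  have hfin : IsFiniteMeasure m := ⟨(hmM univ).trans_lt (by
    simpa using hM.lt_top)⟩
  have hmball : ∀ z ρ σ, 0 < σ → ρ < σ →
      m (Metric.closedBall z ρ) ≤ ENNReal.ofReal (M.toReal * K * σ ^ δ) := by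
    intro z ρ σ hσ hρσ
    refine (hmM _).trans ?_
    rw [Measure.smul_apply, smul_eq_mul, mul_assoc, ENNReal.ofReal_mul ENNReal.toReal_nonneg,
      ENNReal.ofReal_toReal hM]
    gcongr
    exact hμ.closedBall_le z hσ hρσ
  obtain ⟨C, hC, hfrost⟩ := hμ.exists_frostman ht htδ.le
  set R : ℕ → ℝ := fun n => Metric.diam (F n) with hR
  have hRt : ∀ n, 0 < c * R n ^ t := fun n => mul_pos hc (Real.rpow_pos_of_pos (hF0 n) t)
  choose h Mh L hprob hMh hhM hLc hLV hL hhball using fun n => hfrost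
    (U ∩ Metric.thickening (R n) (F n)) (hUo.inter Metric.isOpen_thickening) (c * R n ^ t)
    (hRt n) (hU n)
  have hne : ∀ n, (F n).Nonempty := fun n => by
    by_contra hn
    have := hF0 n
    rw [not_nonempty_iff_eq_empty.1 hn, Metric.diam_empty] at this
    exact lt_irrefl _ this
  choose y hy using hne
  have hFy : ∀ n, ∀ z ∈ F n, dist z (y n) ≤ R n := fun n z hz =>
    Metric.dist_le_diam_of_mem (isCompact_univ.isBounded.subset (subset_univ _)) hz (hy n)
  have hLy : ∀ n, L n ⊆ Metric.closedBall (y n) (2 * R n) := by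
    intro n z hz
    obtain ⟨w, hw, hzw⟩ := Metric.mem_thickening_iff.1 (hLV n hz).2
    rw [Metric.mem_closedBall]
    linarith [dist_triangle z w (y n), hFy n w hw]
  -- the scale `η`: first `θ` controls large balls, then `η` makes small balls negligible
  obtain ⟨θ, hθ, hAθ⟩ := exists_mul_one_add_rpow_le A t (half_pos hε)
  set D₁ : ℝ := M.toReal * K * 16 ^ δ * (C / c) with hD₁
  set D₂ : ℝ := M.toReal * K * 36 ^ δ * (1 / θ) ^ (δ - t) with hD₂
  have hM0 : 0 ≤ M.toReal := ENNReal.toReal_nonneg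
  have hD₁0 : 0 ≤ D₁ := by positivity
  have hD₂0 : 0 ≤ D₂ := by positivity
  obtain ⟨η, hη, hDη⟩ := exists_rpow_le (a := D₁ + D₂) (sub_pos.2 htδ) (half_pos hε)
  have hηt : 0 < η ^ (δ - t) := Real.rpow_pos_of_pos hη _
  let S : Set ℕ := {n | R n < η ∧ Metric.closedBall (y n) (4 * R n) ⊆ O}
  obtain ⟨u, huS, hudisj, hucov⟩ :=
    Vitali.exists_disjoint_subfamily_covering_enlargement_closedBall S y (fun n => 3 * R n)
      (3 * η) (fun n hn => by have := hn.1; linarith) 5 (by norm_num)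
  let Q : ℕ → Set Y := fun n => if n ∈ u then Metric.closedBall (y n) (15 * R n) else ∅
  have hQm : ∀ n, MeasurableSet (Q n) := by
    intro n
    by_cases hn : n ∈ u
    · simpa [Q, hn] using measurableSet_closedBall
    · simp [Q, hn]
  set P : ℕ → Set Y := disjointed Q with hPdef
  have hPQ : ∀ n, P n ⊆ Q n := disjointed_subset Q
  have hPm : ∀ n, MeasurableSet (P n) := fun n => MeasurableSet.disjointed hQm n
  have hPd : Pairwise (Function.onFun Disjoint P) := disjoint_disjointed Q
  have hPu : ∀ n ∉ u, P n = ∅ := fun n hn => by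
    have := hPQ n
    simpa [Q, hn] using this
  have hP : ∀ n ∈ u, P n ⊆ Metric.closedBall (y n) (15 * R n) := fun n hn => by
    have := hPQ n
    simpa [Q, hn] using this
  have hcover : ∀ᵐ z ∂m, z ∈ ⋃ n, P n := by
    have hac : m ≪ μ := Measure.absolutelyContinuous_of_le_smul hmM
    have hO' : ∀ᵐ z ∂m, z ∈ O := by
      rw [ae_iff]
      exact hm.compl_eq_zero
    filter_upwards [hac.ae_le hF, hO'] with z hz hzO
    obtain ⟨τ, hτ, hτO⟩ := Metric.isOpen_iff.1 hO z hzO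
    have hev : ∀ᶠ n in atTop, R n < min η (τ / 6) :=
      hFlim.eventually_lt_const (lt_min hη (by positivity))
    obtain ⟨n, hzn, hn⟩ := (hz.and_eventually hev).exists
    have hnS : n ∈ S := by
      refine ⟨hn.trans_le (min_le_left _ _), fun w hw => hτO ?_⟩
      have h1 := hn.trans_le (min_le_right _ _)
      have h2 := hFy n z hzn
      rw [Metric.mem_closedBall] at hw
      rw [Metric.mem_ball]
      have h3 := hF0 n
      simp only [hR] at *
      linarith [dist_triangle_right w z (y n)]
    obtain ⟨b, hb, hnb⟩ := hucov n hnS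
    rw [hPdef, iUnion_disjointed]
    refine mem_iUnion.2 ⟨b, ?_⟩
    have hz3 : z ∈ Metric.closedBall (y n) (3 * R n) := by
      rw [Metric.mem_closedBall]
      linarith [hFy n z hzn, hF0 n, show R n = Metric.diam (F n) from rfl]
    have := hnb hz3
    rw [← mul_assoc] at this
    norm_num at this
    simpa [Q, hb] using this
  have htsum : m univ = ∑' n, m (P n) := by
    rw [← measure_iUnion hPd hPm]
    exact measure_congr (eventuallyEq_univ.2 hcover).symm
  obtain ⟨k, hk⟩ : ∃ k, m univ ≤ ∑ n ∈ Finset.range k, m (P n) + ENNReal.ofReal ε := by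
    have hlim := (ENNReal.tendsto_nat_tsum fun n => m (P n)).add_const (ENNReal.ofReal ε)
    rw [← htsum] at hlim
    have hlt : m univ < m univ + ENNReal.ofReal ε :=
      ENNReal.lt_add_right (measure_ne_top _ _) (ENNReal.ofReal_pos.2 hε).ne'
    obtain ⟨k, hk⟩ := (hlim.eventually_const_lt hlt).exists
    exact ⟨k, hk.le⟩
  let L' : Set Y := ⋃ n ∈ (Finset.range k).filter (· ∈ u), L n
  have hL'c : IsClosed L' := isClosed_biUnion_finset fun n _ => hLc n
  have hL'U : L' ⊆ U ∩ O := by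
    refine iUnion₂_subset fun n hn z hz => ⟨(hLV n hz).1, ?_⟩
    have hnu := (Finset.mem_filter.1 hn).2
    refine (huS hnu).2 (Metric.closedBall_subset_closedBall ?_ (hLy n hz))
    linarith [hF0 n, show R n = Metric.diam (F n) from rfl]
  obtain ⟨O', hO'o, hLO', hO'U⟩ := normal_exists_closure_subset hL'c (hUo.inter hO) hL'U
  refine ⟨∑ n ∈ Finset.range k, m (P n) • h n, O', hO'o, hO'U, ⟨?_, ?_, ?_⟩, ?_⟩
  · refine ⟨∑ n ∈ Finset.range k, m (P n) * Mh n, ENNReal.sum_ne_top.2 fun n _ =>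
      ENNReal.mul_ne_top (measure_ne_top _ _) (hMh n), ?_⟩
    rw [Finset.sum_smul]
    intro B
    simp only [Measure.finsetSum_apply, Measure.smul_apply, smul_eq_mul]
    refine Finset.sum_le_sum fun n _ => ?_
    rw [mul_assoc]
    gcongr
    exact hhM n B
  · rw [Measure.finsetSum_apply]
    refine Finset.sum_eq_zero fun n hn => ?_
    rw [Measure.smul_apply, smul_eq_mul]
    by_cases hnu : n ∈ u
    · rw [measure_mono_null _ (hL n), mul_zero]
      refine compl_subset_compl.2 (Subset.trans ?_ hLO')
      exact subset_biUnion_of_mem (u := L) (Finset.mem_filter.2 ⟨hn, hnu⟩)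
    · simp [hPu n hnu]
  · intro x ρ hρ
    rw [Measure.finsetSum_apply]
    simp only [Measure.smul_apply, smul_eq_mul]
    have hρt : 0 < ρ ^ t := Real.rpow_pos_of_pos hρ t
    have hB : ∀ n ∈ u, m (P n) * h n (Metric.ball x ρ) ≤
        ENNReal.ofReal (D₁ * η ^ (δ - t) * ρ ^ t) := by
      intro n hn
      have hRn : 0 < R n := hF0 n
      calc m (P n) * h n (Metric.ball x ρ)
          ≤ ENNReal.ofReal (M.toReal * K * (16 * R n) ^ δ) *
            ENNReal.ofReal (C / (c * R n ^ t) * ρ ^ t) := by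
            gcongr
            · exact (measure_mono (hP n hn)).trans
                (hmball _ _ _ (by positivity) (by linarith))
            · exact hhball n x ρ hρ
        _ = ENNReal.ofReal (D₁ * R n ^ (δ - t) * ρ ^ t) := by
            rw [← ENNReal.ofReal_mul (by positivity)]
            congr 1
            rw [hD₁, Real.mul_rpow (by norm_num) hRn.le, Real.rpow_sub hRn]
            field_simp
        _ ≤ _ := by
            gcongr
            exact (huS hn).1.le
    refine (sum_redistributed_ball_le hprob hudisj hPu hP hPm hPd hL hLy
      (fun n hn => (huS hn).1) hρ x hB k).trans ?_
    have hfirst : m (Metric.ball x (ρ + 17 * min η (2 * ρ))) ≤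
        ENNReal.ofReal ((A + ε / 2) * ρ ^ t + D₂ * η ^ (δ - t) * ρ ^ t) := by
      have hmin0 : 0 < min η (2 * ρ) := lt_min hη (by positivity)
      rcases le_or_gt η (θ * ρ) with hle | hlt
      · refine (hm.ball_le x _ (by positivity)).trans (ENNReal.ofReal_le_ofReal ?_)
        calc A * (ρ + 17 * min η (2 * ρ)) ^ t ≤ A * ((1 + 17 * θ) * ρ) ^ t := by
              gcongr
              linarith [min_le_left η (2 * ρ)]
          _ = A * (1 + 17 * θ) ^ t * ρ ^ t := by
              rw [Real.mul_rpow (by positivity) hρ.le, mul_assoc]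
          _ ≤ (A + ε / 2) * ρ ^ t := by gcongr
          _ ≤ _ := le_add_of_nonneg_right (by positivity)
      · refine (measure_mono Metric.ball_subset_closedBall).trans
          ((measure_mono (Metric.closedBall_subset_closedBall (ε₂ := 35 * ρ) ?_)).trans
            ((hmball x _ (36 * ρ) (by positivity) (by linarith)).trans
              (ENNReal.ofReal_le_ofReal ?_)))
        · linarith [min_le_right η (2 * ρ)]
        calc M.toReal * K * (36 * ρ) ^ δ
            = M.toReal * K * 36 ^ δ * ρ ^ (δ - t) * ρ ^ t := by
              rw [Real.mul_rpow (by norm_num) hρ.le, mul_assoc _ (ρ ^ (δ - t)),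
                ← Real.rpow_add hρ, sub_add_cancel]
              ring
          _ ≤ M.toReal * K * 36 ^ δ * (1 / θ * η) ^ (δ - t) * ρ ^ t := by
              gcongr
              rw [one_div, ← div_eq_inv_mul, le_div_iff₀ hθ]
              linarith
          _ = D₂ * η ^ (δ - t) * ρ ^ t := by
              rw [Real.mul_rpow (by positivity) hη.le, hD₂]
              ring
          _ ≤ _ := le_add_of_nonneg_left (by positivity)
    refine (add_le_add_left hfirst _).trans ?_
    rw [← ENNReal.ofReal_add (by positivity) (by positivity)]
    apply ENNReal.ofReal_le_ofReal
    have : (D₁ + D₂) * η ^ (δ - t) * ρ ^ t ≤ ε / 2 * ρ ^ t := by gcongr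
    nlinarith
  · refine hk.trans_eq ?_
    congr 1
    rw [Measure.finsetSum_apply]
    refine Finset.sum_congr rfl fun n _ => ?_
    have := hprob n
    simp

end Dispersion

/-! ### Intersections of open sets with large content -/

section Intersection

variable {Y : Type*} [MetricSpace Y] [CompactSpace Y] [MeasurableSpace Y] [BorelSpace Y]
  {δ K : ℝ} {μ : Measure Y} [IsProbabilityMeasure μ]

/-- Moving a measure successively into the sets `U n` costs an arbitrarily small part of its mass
and of its growth bound. By compactness, a cover of the intersection covers the support of one of
the measures, so it cannot be cheap. The bound does not depend on `c`. -/
theorem IsFrostmanOn.le_radiusContent_iInter_inter (hμ : AhlforsBounds δ K μ) {t A a : ℝ}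
    (ht : 0 < t) (htδ : t < δ) (hA : 0 < A) (ha : 0 < a) {F : ℕ → Set Y}
    (hF0 : ∀ n, 0 < Metric.diam (F n)) (hFlim : Tendsto (fun n => Metric.diam (F n)) atTop (𝓝 0))
    (hF : ∀ᵐ x ∂μ, ∃ᶠ n in atTop, x ∈ F n) {U : ℕ → Set Y} (hUo : ∀ k, IsOpen (U k)) {c : ℝ}
    (hc : 0 < c) (hU : ∀ k n, ENNReal.ofReal (c * Metric.diam (F n) ^ t) ≤
      radiusContent t (U k ∩ Metric.thickening (Metric.diam (F n)) (F n)))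
    {O : Set Y} (hO : IsOpen O) {m : Measure Y} (hm : IsFrostmanOn μ t A O m)
    (hma : ENNReal.ofReal a ≤ m univ) :
    ENNReal.ofReal (a / (4 * A)) ≤ radiusContent t ((⋂ k, U k) ∩ O) := by
  obtain ⟨e, he, heA, hea⟩ : ∃ e : ℝ, 0 < e ∧ e ≤ A ∧ e ≤ a / 2 :=
    ⟨min A (a / 2), lt_min hA (half_pos ha), min_le_left _ _, min_le_right _ _⟩
  let Good : ℕ → Measure Y × Set Y → Prop := fun n p => IsOpen p.2 ∧
    IsFrostmanOn μ t (A + (e - e / 2 ^ n)) p.2 p.1 ∧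
    ENNReal.ofReal a ≤ p.1 univ + ENNReal.ofReal (e - e / 2 ^ n)
  have hle : ∀ n : ℕ, e / 2 ^ n ≤ e := fun n => div_le_self he.le (one_le_pow₀ one_le_two)
  have hstep : ∀ n (p : {p // Good n p}),
      ∃ q : {q // Good (n + 1) q}, closure q.1.2 ⊆ U n ∩ p.1.2 := by
    rintro n ⟨⟨m, O⟩, hO, hm, hma⟩
    have hn := hle n
    have hε : 0 < e / 2 ^ (n + 1) := by positivity
    have heq : e - e / 2 ^ n + e / 2 ^ (n + 1) = e - e / 2 ^ (n + 1) := by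
      rw [pow_succ]
      field_simp
      ring
    obtain ⟨m', O', hO', hcl, hm', hmass⟩ := hm.exists_dispersion hμ ht htδ
      (by linarith) hc hε hF0 hFlim hF (hUo n) hO (hU n)
    refine ⟨⟨(m', O'), hO', ?_, ?_⟩, hcl⟩
    · rw [← heq, ← add_assoc]
      exact hm'
    · refine hma.trans ((add_le_add_left hmass _).trans (le_of_eq ?_))
      rw [← heq, add_comm (e - e / 2 ^ n), ENNReal.ofReal_add hε.le (by linarith), add_assoc]
  choose next hnext using hstep
  let p : ∀ n, {p // Good n p} := fun n => Nat.rec ⟨(m, O), hO, by simpa using hm,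
    by simpa using hma⟩ next n
  have hp : ∀ n, closure (p (n + 1)).1.2 ⊆ U n ∩ (p n).1.2 := fun n => hnext n (p n)
  have hanti : Antitone fun n => closure (p (n + 1)).1.2 :=
    antitone_nat_of_succ_le fun n => (hp (n + 1)).trans (inter_subset_right.trans subset_closure)
  have hlim : ⋂ n, closure (p (n + 1)).1.2 ⊆ (⋂ k, U k) ∩ O := fun z hz =>
    ⟨mem_iInter.2 fun k => (hp k (mem_iInter.1 hz k)).1, (hp 0 (mem_iInter.1 hz 0)).2⟩
  refine le_radiusContent fun 𝓑 h𝓑 hpos hcov => ?_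
  have hW : IsOpen (⋃ b ∈ 𝓑, Metric.ball b.1 b.2) :=
    isOpen_biUnion fun b _ => Metric.isOpen_ball
  obtain ⟨n, hn⟩ := exists_subset_nhds_of_isCompact hanti.directed_ge
    (fun n => isClosed_closure.isCompact)
    fun z hz => hW.mem_nhds (hcov (hlim hz))
  obtain ⟨-, hfr, hmass⟩ := (p (n + 1)).2
  set m' := (p (n + 1)).1.1
  set O' := (p (n + 1)).1.2
  have h𝓑' := h𝓑.to_subtype
  have hn1 := hle (n + 1)
  have hn0 : 0 < e / 2 ^ (n + 1) := by positivity
  have hm' : m' univ ≤ ENNReal.ofReal (2 * A) * ∑' b : 𝓑, ENNReal.ofReal (b.1.2 ^ t) := by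
    calc m' univ = m' O' + m' O'ᶜ := by
          rw [measure_add_measure_compl (p (n + 1)).2.1.measurableSet]
      _ ≤ m' (⋃ b ∈ 𝓑, Metric.ball b.1 b.2) := by
          rw [hfr.compl_eq_zero, add_zero]
          exact measure_mono (subset_closure.trans hn)
      _ ≤ ∑' b : 𝓑, m' (Metric.ball b.1.1 b.1.2) := measure_biUnion_le _ h𝓑 _
      _ ≤ ∑' b : 𝓑, ENNReal.ofReal (2 * A) * ENNReal.ofReal (b.1.2 ^ t) := by
          refine ENNReal.tsum_le_tsum fun b => ?_
          have hb := hpos _ b.2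
          refine (hfr.ball_le _ _ hb).trans ?_
          rw [← ENNReal.ofReal_mul (by positivity)]
          gcongr
          linarith
      _ = _ := ENNReal.tsum_mul_left
  have hhalf : ENNReal.ofReal (a / 2) ≤ m' univ := by
    refine (ENNReal.add_le_add_iff_right (ENNReal.ofReal_ne_top (r := a / 2))).1 ?_
    rw [← ENNReal.ofReal_add (by positivity) (by positivity), add_halves]
    refine hmass.trans ?_
    gcongr
    linarith
  have heq : a / (4 * A) = a / 2 / (2 * A) := by
    field_simp
    norm_num
  rw [heq, ENNReal.ofReal_div_of_pos (by positivity)]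
  exact ENNReal.div_le_of_le_mul' (hhalf.trans hm')

/-- The restriction of `μ` to a ball of radius `r` is a starting measure whose mass and growth
constant depend on `t` through powers of `r` only. -/
theorem AhlforsBounds.le_radiusContent_iInter_inter_ball (hμ : AhlforsBounds δ K μ) {t : ℝ}
    (ht : 0 < t) (htδ : t < δ) {F : ℕ → Set Y}
    (hF0 : ∀ n, 0 < Metric.diam (F n)) (hFlim : Tendsto (fun n => Metric.diam (F n)) atTop (𝓝 0))
    (hF : ∀ᵐ x ∂μ, ∃ᶠ n in atTop, x ∈ F n) {U : ℕ → Set Y} (hUo : ∀ k, IsOpen (U k)) {c : ℝ}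
    (hc : 0 < c) (hU : ∀ k n, ENNReal.ofReal (c * Metric.diam (F n) ^ t) ≤
      radiusContent t (U k ∩ Metric.thickening (Metric.diam (F n)) (F n)))
    (x : Y) {r : ℝ} (hr : 0 < r) (hrd : r ≤ Metric.diam (univ : Set Y)) :
    ENNReal.ofReal (r ^ t / (4 * K ^ 2)) ≤ radiusContent t ((⋂ k, U k) ∩ Metric.ball x r) := by
  have hK : 0 < K := one_pos.trans_le hμ.one_le
  have hrt : r ^ δ = r ^ (δ - t) * r ^ t := by rw [← Real.rpow_add hr, sub_add_cancel]
  have hm : IsFrostmanOn μ t (K * r ^ (δ - t)) (Metric.ball x r) (μ.restrict (Metric.ball x r)) := by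
    refine ⟨⟨1, ENNReal.one_ne_top, by simpa using Measure.restrict_le_self⟩, ?_,
      fun y ρ hρ => ?_⟩
    · rw [Measure.restrict_apply measurableSet_ball.compl, compl_inter_self, measure_empty]
    · have hρt : ρ ^ δ = ρ ^ (δ - t) * ρ ^ t := by rw [← Real.rpow_add hρ, sub_add_cancel]
      have hδt : 0 ≤ δ - t := by linarith
      rcases le_total ρ r with hle | hle
      · refine (Measure.restrict_le_self _).trans ((hμ.upper y ρ hρ).trans ?_)
        rw [hρt, ← mul_assoc]
        gcongr
      · refine (measure_mono (subset_univ _)).trans ?_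
        rw [Measure.restrict_apply_univ]
        refine (hμ.upper x r hr).trans ?_
        rw [hrt, ← mul_assoc]
        gcongr
  have heq : r ^ t / (4 * K ^ 2) = K⁻¹ * r ^ δ / (4 * (K * r ^ (δ - t))) := by
    rw [hrt]
    field_simp
  rw [heq]
  refine hm.le_radiusContent_iInter_inter hμ ht htδ (by positivity) (by positivity) hF0 hFlim hF
    hUo hc hU Metric.isOpen_ball ?_
  rw [Measure.restrict_apply_univ]
  exact hμ.lower x r hr hrd

end Intersection

/-! ### The large intersection property -/

theorem EReal.coe_lt_of_lt_toReal {a : ℝ} {e : EReal} (ha : 0 ≤ a) (h : a < e.toReal) :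
    (a : EReal) < e := by
  induction e with
  | bot => exact absurd h (by simpa using ha)
  | coe e => exact EReal.coe_lt_coe_iff.2 (by simpa using h)
  | top => exact EReal.coe_lt_top a

theorem limsup_eq_iInter_iUnion {Y : Type*} (E : ℕ → Set Y) :
    limsup E atTop = ⋂ N, ⋃ n ≥ N, E n := by
  rw [limsup_eq_iInf_iSup_of_nat]
  rfl

/-- The content of subsets of small balls forces the exponent `D` to be at least `s`. -/
theorem le_of_forall_le_radiusContent {Y : Type*} [PseudoMetricSpace Y] {s D c : ℝ} (hc : 0 < c)
    {x : ℕ → Y} {r : ℕ → ℝ} (hr : ∀ n, 0 < r n) (hr0 : Tendsto r atTop (𝓝 0)) {E : ℕ → Set Y}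
    (hEB : ∀ n, E n ⊆ Metric.ball (x n) (r n))
    (hE : ∀ n, ENNReal.ofReal (c * r n ^ D) ≤ radiusContent s (E n)) : s ≤ D := by
  by_contra! hlt
  have h1 := (Real.continuousAt_rpow_const 0 (s - D) (Or.inr (by linarith))).tendsto
  rw [Real.zero_rpow (by linarith)] at h1
  obtain ⟨n, hn⟩ := ((h1.comp hr0).eventually_lt_const hc).exists
  have h2 := (hE n).trans (radiusContent_subset_ball_le (x n) (hr n) (hEB n))
  have hrs : 0 < r n ^ s := Real.rpow_pos_of_pos (hr n) s
  rw [ENNReal.ofReal_le_ofReal_iff hrs.le, ← le_div_iff₀ (Real.rpow_pos_of_pos (hr n) D),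
    ← Real.rpow_sub (hr n)] at h2
  exact absurd hn (not_lt.2 h2)

/-- The intrinsic form of the large intersection property, with a constant that does not depend on
the exponent `t < s`. -/
theorem le_radiusContent_limsup_inter_ball {Y : Type*} [MetricSpace Y] [CompactSpace Y]
    [MeasurableSpace Y] [BorelSpace Y] {δ K s c t : ℝ} {μ ν : Measure Y} [IsProbabilityMeasure μ]
    (hμ : AhlforsBounds δ K μ) {F : ℕ → Set Y} (hν : IsQuasiSelfConformal ν F)
    (hFlim : Tendsto (fun n => Metric.diam (F n)) atTop (𝓝 0)) (hF : μ (limsup F atTop) = 1)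
    {x : ℕ → Y} {r : ℕ → ℝ} (hr : ∀ n, 0 < r n) {E : ℕ → Set Y} (hE : ∀ n, IsOpen (E n))
    (hr0 : Tendsto r atTop (𝓝 0))
    (hB : ν (limsup (fun n => Metric.ball (x n) (r n)) atTop) = 1)
    (hEB : ∀ n, E n ⊆ Metric.ball (x n) (r n)) (hc : 0 < c)
    (hcontent : ∀ n, ENNReal.ofReal (c * r n ^ (upperHausdorffDim ν).toReal) ≤
      radiusContent s (E n))
    (ht : 0 < t) (hts : t < s) (hsδ : s ≤ δ) (z : Y) {ρ : ℝ} (hρ : 0 < ρ)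
    (hρd : ρ ≤ Metric.diam (univ : Set Y)) :
    ENNReal.ofReal (ρ ^ t / (4 * K ^ 2)) ≤
      radiusContent t (limsup E atTop ∩ Metric.ball z ρ) := by
  have := hν.isProbabilityMeasure
  have hsD := le_of_forall_le_radiusContent hc hr hr0 hEB hcontent
  set D := (upperHausdorffDim ν).toReal
  -- half of the gap `s - t` goes to the local dimension, the other half to the contents
  have ha : 0 ≤ D - (s - t) / 2 := by linarith
  obtain ⟨c₁, C, hc₁, hC, hdecay⟩ := hν.exists_decay hμ.diam_pos ha
    (EReal.coe_lt_of_lt_toReal ha (by linarith))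
  have hfreq : ∀ᵐ y ∂μ, ∃ᶠ n in atTop, y ∈ F n := by
    have h0 : μ (limsup F atTop)ᶜ = 0 := by
      rw [prob_compl_eq_zero_iff]
      · exact hF
      · exact MeasurableSet.measurableSet_limsup fun n => (hν.isClosed n).measurableSet
    filter_upwards [compl_mem_ae_iff.2 h0] with y hy
    rw [compl_compl, mem_limsup_iff_frequently_mem] at hy
    exact hy
  rw [limsup_eq_iInter_iUnion]
  refine hμ.le_radiusContent_iInter_inter_ball ht (hts.trans_le hsδ) (fun n => (hdecay n).1) hFlim
    hfreq (fun N => isOpen_biUnion fun n _ => hE n)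
    (c := c₁ / (C * (3 ^ t + 1))) (by have := one_pos.trans_le hC; positivity)
    (fun N n => ?_) z hρ hρd
  obtain ⟨hR, hF0, H, hHF, hH, hHball⟩ := hdecay n
  exact le_radiusContent_inter_thickening hc₁ hC ht.le (by linarith) hts.le (by linarith) hc hR hR
    hF0 hHF hH hHball hr hr0 hEB hB hcontent N

theorem theoremt {d : ℕ} (X : Set (EuclideanSpace ℝ (Fin d))) (hX : IsCompact X)
    (δ : ℝ) (μ : Measure X) (hμ : IsAhlforsRegular δ μ)
    (ν : Measure X) (F : ℕ → Set X) (hν : IsQuasiSelfConformal ν F)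
    (hFdiam : Tendsto (fun n => Metric.diam (F n)) atTop (𝓝 0))
    (hF : μ (limsup F atTop) = 1)
    (x : ℕ → X) (r : ℕ → ℝ) (hr : ∀ n, 0 < r n) (E : ℕ → Set X) (hE : ∀ n, IsOpen (E n))
    (hr0 : Tendsto r atTop (𝓝 0))
    (hB : ν (limsup (fun n => Metric.ball (x n) (r n)) atTop) = 1)
    (hEB : ∀ n, E n ⊆ Metric.ball (x n) (r n))
    (s : ℝ) (hs : 0 ≤ s)
    (hcontent : ∃ c : ℝ, 0 < c ∧ ∀ n,
      ENNReal.ofReal (c * r n ^ (upperHausdorffDim ν).toReal) ≤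
        hausdorffContent s (Subtype.val '' E n)) :
    ENNReal.ofReal s ≤ dimH X ∧ limsup E atTop ∈ largeIntersectionClass X s := by
  have := isCompact_iff_compactSpace.1 hX
  have := hμ.isProbabilityMeasure
  obtain ⟨K, hK⟩ := hμ.exists_bounds
  have hK0 : 0 < K := one_pos.trans_le hK.one_le
  obtain ⟨c, hc, hcE⟩ := hcontent
  have h2s : (0 : ℝ) < 2 ^ s := by positivity
  have hcontent' : ∀ n, ENNReal.ofReal (c / 2 ^ s * r n ^ (upperHausdorffDim ν).toReal) ≤
      radiusContent s (E n) := by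
    intro n
    rw [div_mul_eq_mul_div, ENNReal.ofReal_div_of_pos h2s]
    exact ENNReal.div_le_of_le_mul' ((hcE n).trans (hausdorffContent_image_le_radiusContent hs _))
  have hsδ : s ≤ δ := by
    refine hK.le_of_radiusContent_pos (ne_of_gt ?_)
    refine lt_of_lt_of_le (ENNReal.ofReal_pos.2 ?_)
      ((hcontent' 0).trans (radiusContent_mono (subset_univ _)))
    have := Real.rpow_pos_of_pos (hr 0) (upperHausdorffDim ν).toReal
    positivity
  refine ⟨?_, ?_, ?_⟩
  · have h1 := hK.le_dimH hμ.measure_singleton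
    rw [← isometry_subtype_coe.dimH_image, image_univ, Subtype.range_coe] at h1
    exact (ENNReal.ofReal_le_ofReal hsδ).trans h1
  · rw [limsup_eq_iInter_iUnion]
    exact IsGδ.iInter_of_isOpen fun N => isOpen_biUnion fun n _ => hE n
  · refine ⟨1 / (8 * K ^ 2 * 8 ^ s), by positivity, fun t ht hts z ρ hρ => ?_⟩
    -- radii beyond the diameter of `X` give the same ball of `X`
    set ρ' := min ρ (Metric.diam (univ : Set X)) with hρ'
    have hρ'0 : 0 < ρ' := lt_min hρ hK.diam_pos
    have hupper : hausdorffContent t (Subtype.val '' Metric.ball z ρ) ≤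
        ENNReal.ofReal ((2 * (2 * ρ')) ^ t) := by
      refine hausdorffContent_subset_ball_le ht.le (z : EuclideanSpace ℝ (Fin d))
        (by positivity) ?_
      rintro _ ⟨w, hw, rfl⟩
      have h1 : dist w z ≤ ρ' := le_min (Metric.mem_ball.1 hw).le
        (Metric.dist_le_diam_of_mem isCompact_univ.isBounded (mem_univ w) (mem_univ z))
      rw [Metric.mem_ball, ← Subtype.dist_eq]
      linarith
    have : Nontrivial (EuclideanSpace ℝ (Fin d)) := by
      by_contra hn
      rw [not_nontrivial_iff_subsingleton] at hn
      exact hK.diam_pos.ne' (Metric.diam_subsingleton (subsingleton_of_subsingleton))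
    have hlower : ENNReal.ofReal (ρ' ^ t / (4 * K ^ 2) / 2 ^ t) ≤
        hausdorffContent t (Subtype.val '' (limsup E atTop ∩ Metric.ball z ρ)) := by
      rw [ENNReal.ofReal_div_of_pos (by positivity)]
      refine ENNReal.div_le_of_le_mul' (le_trans ?_ (radiusContent_le_hausdorffContent_image ht.le _))
      refine (le_radiusContent_limsup_inter_ball hK hν hFdiam hF hr hE hr0 hB hEB
        (div_pos hc h2s) hcontent' ht hts hsδ z hρ'0 (min_le_right _ _)).trans ?_
      exact radiusContent_mono (inter_subset_inter_right _ (Metric.ball_subset_ball (min_le_left _ _)))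
    refine lt_of_lt_of_le (lt_of_le_of_lt (mul_le_mul_right hupper _) ?_) hlower
    rw [← ENNReal.ofReal_mul (by positivity)]
    refine (ENNReal.ofReal_lt_ofReal_iff (by positivity)).2 ?_
    have h8 : (2 : ℝ) ^ t * 4 ^ t ≤ 8 ^ s := by
      rw [← Real.mul_rpow (by norm_num) (by norm_num), show (2 : ℝ) * 4 = 8 by norm_num]
      exact Real.rpow_le_rpow_of_exponent_le (by norm_num) hts.le
    rw [← mul_assoc, Real.mul_rpow (by norm_num) hρ'0.le, div_div, one_div_mul_eq_div,
      div_lt_div_iff₀ (by positivity) (by positivity)]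
    have hP : 0 < ρ' ^ t * K ^ 2 := by positivity
    have h8s : (0 : ℝ) < 8 ^ s := by positivity
    norm_num
    nlinarith [mul_le_mul_of_nonneg_left h8 hP.le, mul_pos hP h8s]
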